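/- Let $(\Omega,\mathcal F,P)$ be a probability space carrying a $d$-dimensional standard Brownian motion $(B_t)_{t\ge 0}$, let $T>0$, $x_0\in\mathbb R^m$, and let $b:[0,T]\to\mathbb R^{m\times m}$ be integrable and $\sigma:[0,T]\to\mathbb R^{m\times d}$ be square-integrable deterministic matrix-valued functions. Let $X$ be a solution with continuous paths on $[0,T]$ of the linear stochastic differential equation with additive noise $$dX_t=b(t)X_t\,dt+\sigma(t)\,dB_t,\qquad X_0=x_0,$$ and let $Y$ be the first variation process, i.e. the continuous $\mathbb R^{m\times m}$-valued solution on $[0,T]$ of $dY_t=b(t)Y_t\,dt$, $Y_0=I_m$. Let $H=L^2(\mathbb R_+;\mathbb R^d)$ and write $B(h)=\int_0^\infty h(t)\cdot dB_t$ for $h\in H$. The Malliavin derivative $D$, with domain $\mathbb D^{1,2}$, is the closure in $L^2(\Omega)\times L^2(\Omega;H)$ of the operator $D_rF=\sum_{i=1}^n\partial_i f(B(h_1),\dots,B(h_n))\,h_i(r)$ on the functionals $F=f(B(h_1),\dots,B(h_n))$, where $n\in\mathbb N$, $h_i\in H$, and $f\in C^\infty(\mathbb R^n)$ has polynomial growth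 together with all its derivatives. For a random vector $F=(F^1,\dots,F^m)$ with components in $\mathbb D^{1,2}$, $D_rF$ is the $m\times d$ matrix with rows $D_rF^i$, and the Malliavin matrix is $\gamma_F=(\langle DF^i,DF^j\rangle_H)_{1\le i,j\le m}$. Then $Y_r$ is invertible for every $r\in[0,T]$, every component of $X_T$ belongs to $\mathbb D^{1,2}$, and, for almost every $(\omega,r)$, $$D_rX_T=Y_TY_r^{-1}\sigma(r)\quad\text{if } 0< r\le T,\qquad D_rX_T=0\quad\text{if } r>T.$$ Hence the function $r\mapsto Y_r^{-1}\sigma(r)\sigma(r)^\top(Y_r^{-1})^\top$ is integrable on $[0,T]$ and, almost surely, $$\gamma_{X_T}=Y_T\left(\int_0^T Y_r^{-1}\sigma(r)\sigma(r)^\top(Y_r^{-1})^\top\,dr\right)Y_T^\top .$$ -/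

import Mathlib

open MeasureTheory ProbabilityTheory Filter Topology Set
open scoped NNReal ENNReal

noncomputable section

namespace MalliavinSDE

variable {Ω : Type*} [MeasurableSpace Ω] {d m : ℕ}

/-- A `d`-dimensional standard Brownian motion `(B t)`, `t ≥ 0`: its coordinates are
independent one-dimensional standard Brownian motions. -/
structure IsBrownianMotion (B : ℝ≥0 → Ω → EuclideanSpace ℝ (Fin d)) (P : Measure Ω) : Prop where
  coord : ∀ l, IsBrownianReal (fun t ω => B t ω l) P
  indep : iIndepFun (fun (l : Fin d) (ω : Ω) (t : ℝ≥0) => B t ω l) P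

/-- Lebesgue measure on the half-line `ℝ₊`, so that `H = L²(halfLine; ℝᵈ)`. -/
abbrev halfLine : Measure ℝ := volume.restrict (Ioi 0)

/-- A deterministic `ℝᵈ`-valued step function, given by finitely many
intervals `(s k, t k]` and values `c k`. -/
structure Step (d : ℕ) where
  n : ℕ
  s : Fin n → ℝ≥0
  t : Fin n → ℝ≥0
  le : ∀ k, s k ≤ t k
  c : Fin n → EuclideanSpace ℝ (Fin d)

/-- The function `∑ k, c k 1_{(s k, t k]}`. -/
def Step.toFun (φ : Step d) (r : ℝ) : EuclideanSpace ℝ (Fin d) :=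
  ∑ k, (Ioc (φ.s k : ℝ) (φ.t k : ℝ)).indicator (fun _ => φ.c k) r

/-- The elementary integral `∑ k, ⟪c k, B (t k) - B (s k)⟫`. -/
def Step.integral (φ : Step d) (B : ℝ≥0 → Ω → EuclideanSpace ℝ (Fin d)) (ω : Ω) : ℝ :=
  ∑ k, inner ℝ (φ.c k) (B (φ.t k) ω - B (φ.s k) ω)

/-- `Z` is (a version of) the Wiener integral `B(h) = ∫₀^∞ h(r) · dB_r` of `h ∈ H`: the
`L²(Ω)`-limit of the elementary integrals of step functions that converge to `h` in `H`. This is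
the Itô integral of the deterministic integrand `h`. -/
def IsWienerIntegral (B : ℝ≥0 → Ω → EuclideanSpace ℝ (Fin d)) (P : Measure Ω)
    (h : ℝ → EuclideanSpace ℝ (Fin d)) (Z : Ω → ℝ) : Prop :=
  MemLp h 2 halfLine ∧ MemLp Z 2 P ∧
    ∃ φ : ℕ → Step d,
      Tendsto (fun k => eLpNorm ((φ k).toFun - h) 2 halfLine) atTop (𝓝 0) ∧
      Tendsto (fun k => eLpNorm ((φ k).integral B - Z) 2 P) atTop (𝓝 0)

/-- `F = f(B(h₁), …, B(hₙ))` is a smooth cylindrical functional, where `f` is smooth and `f` and all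
its derivatives have polynomial growth, and `G ω r = ∑ᵢ ∂ᵢf(B(h₁), …, B(hₙ)) hᵢ(r)` is its
Malliavin derivative `D_r F`. -/
def IsCylindricalPair (B : ℝ≥0 → Ω → EuclideanSpace ℝ (Fin d)) (P : Measure Ω)
    (F : Ω → ℝ) (G : Ω → ℝ → EuclideanSpace ℝ (Fin d)) : Prop :=
  ∃ (n : ℕ) (f : EuclideanSpace ℝ (Fin n) → ℝ) (h : Fin n → ℝ → EuclideanSpace ℝ (Fin d))
    (W : Ω → EuclideanSpace ℝ (Fin n)),
    f.HasTemperateGrowth ∧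
    (∀ i, IsWienerIntegral B P (h i) (fun ω => W ω i)) ∧
    (F = fun ω => f (W ω)) ∧
    (G = fun ω r => ∑ i, fderiv ℝ f (W ω) (EuclideanSpace.single i 1) • h i r)

/-- `(F, G)` belongs to the closure in `L²(Ω) × L²(Ω; H)` of the graph of the Malliavin derivative
on smooth cylindrical functionals; `L²(Ω; H)` is `L²(Ω × ℝ₊; ℝᵈ)`. -/
def IsMalliavinDerivative (B : ℝ≥0 → Ω → EuclideanSpace ℝ (Fin d)) (P : Measure Ω)
    (F : Ω → ℝ) (G : Ω → ℝ → EuclideanSpace ℝ (Fin d)) : Prop :=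
  MemLp F 2 P ∧ MemLp (Function.uncurry G) 2 (P.prod halfLine) ∧
    ∃ (F' : ℕ → Ω → ℝ) (G' : ℕ → Ω → ℝ → EuclideanSpace ℝ (Fin d)),
      (∀ k, IsCylindricalPair B P (F' k) (G' k)) ∧
      Tendsto (fun k => eLpNorm (F' k - F) 2 P) atTop (𝓝 0) ∧
      Tendsto (fun k => eLpNorm (Function.uncurry (G' k) - Function.uncurry G) 2
        (P.prod halfLine)) atTop (𝓝 0)

/-- Membership in the Malliavin–Sobolev space `𝔻^{1,2}`. -/
def MemD12 (B : ℝ≥0 → Ω → EuclideanSpace ℝ (Fin d)) (P : Measure Ω) (F : Ω → ℝ) : Prop :=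
  ∃ G, IsMalliavinDerivative B P F G

open Classical in
/-- The Malliavin derivative `D_r F (ω)` of `F ∈ 𝔻^{1,2}` (and zero outside `𝔻^{1,2}`). -/
def malliavinDeriv (B : ℝ≥0 → Ω → EuclideanSpace ℝ (Fin d)) (P : Measure Ω) (F : Ω → ℝ) :
    Ω → ℝ → EuclideanSpace ℝ (Fin d) :=
  if hF : MemD12 B P F then hF.choose else 0

/-- The `m × d` matrix `D_r F (ω)` of a random vector `F`; its `i`-th row is `D_r Fⁱ (ω)`. -/
def malliavinJacobian (B : ℝ≥0 → Ω → EuclideanSpace ℝ (Fin d)) (P : Measure Ω)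
    (F : Ω → Fin m → ℝ) (ω : Ω) (r : ℝ) : Matrix (Fin m) (Fin d) ℝ :=
  Matrix.of fun i l => malliavinDeriv B P (fun ω' => F ω' i) ω r l

/-- The Malliavin matrix `γ_F = (⟨D Fⁱ, D Fʲ⟩_H)` of a random vector `F`. -/
def malliavinMatrix (B : ℝ≥0 → Ω → EuclideanSpace ℝ (Fin d)) (P : Measure Ω)
    (F : Ω → Fin m → ℝ) (ω : Ω) : Matrix (Fin m) (Fin m) ℝ :=
  Matrix.of fun i j => ∫ r, inner ℝ (malliavinDeriv B P (fun ω' => F ω' i) ω r)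
    (malliavinDeriv B P (fun ω' => F ω' j) ω r) ∂halfLine

/-- `X` solves `dX_t = b(t) X_t dt + σ(t) dB_t`, `X_0 = x₀` on `[0, T]`: it has continuous paths and
satisfies the integrated equation; `Z` below is the stochastic integral `∫₀ᵗ σⁱ(s) · dB_s`,
where `σⁱ` is the `i`-th row of `σ`. -/
structure IsLinearSDESolution (B : ℝ≥0 → Ω → EuclideanSpace ℝ (Fin d)) (P : Measure Ω) (T : ℝ)
    (b : ℝ → Matrix (Fin m) (Fin m) ℝ) (σ : ℝ → Matrix (Fin m) (Fin d) ℝ) (x₀ : Fin m → ℝ)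
    (X : ℝ → Ω → Fin m → ℝ) : Prop where
  aemeasurable : ∀ t ∈ Icc 0 T, AEMeasurable (X t) P
  continuousOn : ∀ᵐ ω ∂P, ContinuousOn (fun t => X t ω) (Icc 0 T)
  eq : ∀ t ∈ Icc 0 T, ∀ i, ∃ Z : Ω → ℝ,
    IsWienerIntegral B P ((Ioc 0 t).indicator fun r => WithLp.toLp 2 (σ r i)) Z ∧
    ∀ᵐ ω ∂P, X t ω i = x₀ i + (∫ s in (0 : ℝ)..t, (b s).mulVec (X s ω) i) + Z ω

/-- `Y` is the first variation process of the linear equation: the continuous solution of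
`dY_t = b(t) Y_t dt`, `Y_0 = I` on `[0, T]`. -/
structure IsFirstVariation (T : ℝ) (b : ℝ → Matrix (Fin m) (Fin m) ℝ)
    (Y : ℝ → Matrix (Fin m) (Fin m) ℝ) : Prop where
  continuousOn : ContinuousOn Y (Icc 0 T)
  eq : ∀ t ∈ Icc 0 T, ∀ i j,
    Y t i j = (1 : Matrix (Fin m) (Fin m) ℝ) i j + ∫ s in (0 : ℝ)..t, (b s * Y s) i j

end MalliavinSDE

end

/-!
The equation is linear with additive noise, so its solution lies in the sum of the constants and the
first Wiener chaos. With the row `q = (Y_T Y⁻¹)ᵢ`, which solves the adjoint equation `dq = -q b dt`,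
variation of constants gives `X_T^i = q(0) · x₀ + ∫₀ᵀ q(r) σ(r) · dB_r`. The Malliavin derivative of
a constant plus `B(h)` is `h`, and the formula for the Malliavin matrix follows by integrating
`h hᵀ`.

Variation of constants does not need a stochastic calculus. Write `Z_t = ∫₀ᵗ σ dB`. The sums
`∑ q(s_k) · (Z_{s_{k+1}} - Z_{s_k})` along equidistant partitions are Wiener integrals of integrands
that converge to `1_{(0,T]} q σ` in `H` (`norm_sum_indicator_sub_le`). Along almost every path they
converge to `q(T) · X_T - q(0) · x₀`, by a summation by parts (`tendsto_sum_mul_increment`), because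
`X - Z` and `q` are primitives of integrable functions and Riemann sums against such primitives
converge (`tendsto_riemann_sum`). By the Itô isometry and Fatou's lemma the almost sure limit is the
Wiener integral of the limit (`IsWienerIntegral.of_tendsto_ae`). The same Riemann sums give the
equation for `Y⁻¹` (`IsFirstVariation.inv_eq`); `Y` is invertible by Grönwall's inequality
(`IsFirstVariation.isUnit`).

Since `malliavinDeriv` is a chosen element of the closure of the derivative on cylindrical
functionals, identifying it requires the closability of that operator
(`IsMalliavinDerivative.ae_eq`). If `η` is the difference of two derivatives of `F`, then
integration by parts shows that `η` is orthogonal to every `φ k`, where `φ` is a smooth cylindrical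
functional and `k ∈ H`. The derivatives of the functionals that approximate `F` are finite sums of
such `φ k`, and `η` is a limit of differences of them, so `η` is orthogonal to itself. Integration
by parts (`IsCylindricalPair.integral_inner_eq`) rests on the fact that Wiener integrals are jointly
Gaussian and on Gaussian integration by parts, which is reduced to Stein's identity on the line by
splitting off an independent Gaussian vector
(`HasGaussianLaw.integral_comp_mul_eq_integral_fderiv`).
-/

namespace MalliavinSDE

/-! ### Elementary integrals of step functions -/

section Steps

variable {Ω : Type*} {d : ℕ}

/-- The pointwise sum of two step functions. -/
def Step.add (φ ψ : Step d) : Step d where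
  n := φ.n + ψ.n
  s := Fin.append φ.s ψ.s
  t := Fin.append φ.t ψ.t
  le k := by
    refine Fin.addCases (fun i => ?_) (fun i => ?_) k
    · simpa using φ.le i
    · simpa using ψ.le i
  c := Fin.append φ.c ψ.c

/-- A scalar multiple of a step function. -/
noncomputable def Step.smul (a : ℝ) (φ : Step d) : Step d where
  n := φ.n
  s := φ.s
  t := φ.t
  le := φ.le
  c k := a • φ.c k

lemma Step.toFun_add (φ ψ : Step d) : (φ.add ψ).toFun = φ.toFun + ψ.toFun := by
  ext1 r
  refine (Fin.sum_univ_add (a := φ.n) (b := ψ.n) _).trans ?_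
  simp [Step.toFun, Step.add]

lemma Step.toFun_smul (a : ℝ) (φ : Step d) : (φ.smul a).toFun = a • φ.toFun := by
  ext1 r
  simp only [Step.toFun, Step.smul, Pi.smul_apply, Finset.smul_sum]
  refine Finset.sum_congr rfl fun k _ => ?_
  by_cases h : r ∈ Ioc (φ.s k : ℝ) (φ.t k) <;> simp [h]

lemma Step.integral_add (φ ψ : Step d) (B : ℝ≥0 → Ω → EuclideanSpace ℝ (Fin d)) :
    (φ.add ψ).integral B = φ.integral B + ψ.integral B := by
  ext1 ω
  refine (Fin.sum_univ_add (a := φ.n) (b := ψ.n) _).trans ?_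
  simp [Step.integral, Step.add]

lemma Step.integral_smul (a : ℝ) (φ : Step d) (B : ℝ≥0 → Ω → EuclideanSpace ℝ (Fin d)) :
    (φ.smul a).integral B = a • φ.integral B := by
  ext1 ω
  simp only [Step.integral, Step.smul, Pi.smul_apply, smul_eq_mul, Finset.mul_sum,
    real_inner_smul_left]
  rfl

lemma Step.memLp_toFun (φ : Step d) (p : ℝ≥0∞) : MemLp φ.toFun p halfLine := by
  have : φ.toFun = fun r => ∑ k, (Ioc (φ.s k : ℝ) (φ.t k : ℝ)).indicator (fun _ => φ.c k) r := rfl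
  rw [this]
  refine memLp_finsetSum _ fun k _ => ?_
  refine memLp_indicator_const _ measurableSet_Ioc _ (Or.inr ?_)
  exact ((Measure.restrict_apply_le _ _).trans_lt (by simp)).ne

/-- The contribution of the `l`-th coordinate of `B` to the elementary integral. -/
noncomputable def Step.coordIntegral (φ : Step d) (B : ℝ≥0 → Ω → EuclideanSpace ℝ (Fin d))
    (l : Fin d) (ω : Ω) : ℝ :=
  ∑ k, φ.c k l * (B (φ.t k) ω l - B (φ.s k) ω l)

lemma Step.integral_eq_sum_coord (φ : Step d) (B : ℝ≥0 → Ω → EuclideanSpace ℝ (Fin d)) :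
    φ.integral B = fun ω => ∑ l, φ.coordIntegral B l ω := by
  ext1 ω
  simp only [Step.integral, Step.coordIntegral]
  rw [Finset.sum_comm]
  refine Finset.sum_congr rfl fun k _ => ?_
  simp [PiLp.inner_apply, mul_comm]

section Brownian

variable [MeasurableSpace Ω] {P : Measure Ω} {B : ℝ≥0 → Ω → EuclideanSpace ℝ (Fin d)}

lemma IsBrownianMotion.hasGaussianLaw_coordIntegral (hB : IsBrownianMotion B P) (φ : Step d)
    (l : Fin d) : HasGaussianLaw (φ.coordIntegral B l) P := by
  classical
  let I : Finset ℝ≥0 := Finset.univ.image φ.t ∪ Finset.univ.image φ.s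
  have h1 (k) : φ.t k ∈ I := by simp [I]
  have h2 (k) : φ.s k ∈ I := by simp [I]
  let L : (I → ℝ) →L[ℝ] ℝ := ∑ k, φ.c k l •
    (ContinuousLinearMap.proj (R := ℝ) (φ := fun _ : I => ℝ) ⟨φ.t k, h1 k⟩ -
      ContinuousLinearMap.proj (R := ℝ) (φ := fun _ : I => ℝ) ⟨φ.s k, h2 k⟩)
  refine (((hB.coord l).toIsPreBrownianReal.hasLaw I).hasGaussianLaw.map L).congr
    (ae_of_all _ fun ω => ?_)
  simp [L, Step.coordIntegral, Finset.restrict]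

lemma IsBrownianMotion.memLp_increment (hB : IsBrownianMotion B P) (l : Fin d) (s t : ℝ≥0) :
    MemLp (fun ω => B t ω l - B s ω l) 2 P :=
  ((hB.coord l).toIsPreBrownianReal.hasLaw_sub t s).hasGaussianLaw.memLp_two

lemma IsBrownianMotion.integral_increment (hB : IsBrownianMotion B P) (l : Fin d) (s t : ℝ≥0) :
    ∫ ω, (B t ω l - B s ω l) ∂P = 0 := by
  have h := (hB.coord l).toIsPreBrownianReal
  rw [integral_sub (h.integrable_eval t) (h.integrable_eval s), h.integral_eval, h.integral_eval,
    sub_zero]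

/-- Brownian increments are correlated through the overlap of their time intervals. -/
lemma IsBrownianMotion.covariance_increment (hB : IsBrownianMotion B P) (l : Fin d)
    {s t s' t' : ℝ≥0} (hst : s ≤ t) (hst' : s' ≤ t') :
    cov[fun ω => B t ω l - B s ω l, fun ω => B t' ω l - B s' ω l; P] =
      ∫ r, (Ioc (s : ℝ) t).indicator 1 r * (Ioc (s' : ℝ) t').indicator 1 r ∂halfLine := by
  have h := (hB.coord l).toIsPreBrownianReal
  have hP : IsProbabilityMeasure P := (h.hasLaw_eval 0).hasGaussianLaw.isProbabilityMeasure
  have hm (u : ℝ≥0) : MemLp (fun ω => B u ω l) 2 P :=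
    (h.hasLaw_eval u).hasGaussianLaw.memLp_two
  rw [covariance_fun_sub_fun_sub (hm _) (hm _) (hm _) (hm _)]
  have e : (fun r => (Ioc (s : ℝ) t).indicator (1 : ℝ → ℝ) r * (Ioc (s' : ℝ) t').indicator 1 r)
      = (Ioc ((max s s' : ℝ≥0) : ℝ) ((min t t' : ℝ≥0) : ℝ)).indicator (fun _ => (1 : ℝ)) := by
    ext r
    rw [← inter_indicator_mul, Ioc_inter_Ioc]
    simp [indicator_apply]
  rw [e, integral_indicator measurableSet_Ioc, Measure.restrict_restrict measurableSet_Ioc]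
  have e2 : Ioc ((max s s' : ℝ≥0) : ℝ) ((min t t' : ℝ≥0) : ℝ) ∩ Ioi 0 =
      Ioc ((max s s' : ℝ≥0) : ℝ) ((min t t' : ℝ≥0) : ℝ) :=
    inter_eq_left.2 fun x hx => lt_of_le_of_lt (NNReal.coe_nonneg _) hx.1
  rw [e2]
  have c (u v : ℝ≥0) : cov[fun ω => B u ω l, fun ω => B v ω l; P] = min (u : ℝ) v := by
    rw [h.covariance_fun_eval]; simp
  simp only [c, integral_const, smul_eq_mul, mul_one, Measure.real, Measure.restrict_apply_univ,
    Real.volume_Ioc, NNReal.coe_max, NNReal.coe_min]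
  rw [ENNReal.toReal_ofReal']
  have h1 : (s : ℝ) ≤ t := hst
  have h2 : (s' : ℝ) ≤ t' := hst'
  grind

lemma Step.variance_coordIntegral (hB : IsBrownianMotion B P) (φ : Step d) (l : Fin d) :
    Var[φ.coordIntegral B l; P] = ∫ r, φ.toFun r l ^ 2 ∂halfLine := by
  have h := (hB.coord l).toIsPreBrownianReal
  have hP : IsProbabilityMeasure P := (h.hasLaw_eval 0).hasGaussianLaw.isProbabilityMeasure
  have hi (k k') : Integrable (fun r => (Ioc (φ.s k : ℝ) (φ.t k)).indicator (1 : ℝ → ℝ) r *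
      (Ioc (φ.s k' : ℝ) (φ.t k')).indicator 1 r) halfLine := by
    have hh (k) : MemLp ((Ioc (φ.s k : ℝ) (φ.t k)).indicator (1 : ℝ → ℝ)) 2 halfLine :=
      memLp_indicator_const _ measurableSet_Ioc _
        (Or.inr ((Measure.restrict_apply_le _ _).trans_lt (by simp)).ne)
    exact (hh k).integrable_mul (hh k')
  rw [← covariance_self (hB.hasGaussianLaw_coordIntegral φ l).aemeasurable]
  unfold Step.coordIntegral
  rw [covariance_fun_sum_fun_sum (fun k => (hB.memLp_increment l _ _).const_mul _)
    (fun k => (hB.memLp_increment l _ _).const_mul _)]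
  simp_rw [covariance_const_mul_left, covariance_const_mul_right,
    hB.covariance_increment l (φ.le _) (φ.le _), ← integral_const_mul]
  simp_rw [← integral_finsetSum _ fun k _ => ((hi _ k).const_mul _).const_mul _]
  rw [← integral_finsetSum _ fun k _ => integrable_finsetSum _
    fun k' _ => ((hi k k').const_mul _).const_mul _]
  congr 1 with r
  have e : φ.toFun r l = ∑ k, φ.c k l * (Ioc (φ.s k : ℝ) (φ.t k)).indicator (1 : ℝ → ℝ) r := by
    simp only [Step.toFun, WithLp.ofLp_sum, Finset.sum_apply]
    refine Finset.sum_congr rfl fun k _ => ?_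
    by_cases h : r ∈ Ioc (φ.s k : ℝ) (φ.t k) <;> simp [h]
  rw [e, sq, Finset.sum_mul_sum]
  exact Finset.sum_congr rfl fun k _ => Finset.sum_congr rfl fun k' _ => by ring

lemma Step.iIndepFun_coordIntegral (hB : IsBrownianMotion B P) (φ : Step d) :
    iIndepFun (φ.coordIntegral B) P :=
  hB.indep.comp (fun l p => ∑ k, φ.c k l * (p (φ.t k) - p (φ.s k))) fun l => by fun_prop

/-- The elementary integral of a step function is Gaussian. -/
lemma Step.hasGaussianLaw_integral (hB : IsBrownianMotion B P) (φ : Step d) :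
    HasGaussianLaw (φ.integral B) P := by
  rw [φ.integral_eq_sum_coord B]
  exact (φ.iIndepFun_coordIntegral hB).hasGaussianLaw_fun_sum (hB.hasGaussianLaw_coordIntegral φ)

lemma Step.integral_integral [IsProbabilityMeasure P] (hB : IsBrownianMotion B P) (φ : Step d) :
    ∫ ω, φ.integral B ω ∂P = 0 := by
  rw [φ.integral_eq_sum_coord B,
    integral_finsetSum _ fun l _ => (hB.hasGaussianLaw_coordIntegral φ l).integrable]
  refine Finset.sum_eq_zero fun l _ => ?_
  unfold Step.coordIntegral
  rw [integral_finsetSum _ fun k _ =>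
    ((hB.memLp_increment l _ _).integrable one_le_two).const_mul _]
  simp [integral_const_mul, hB.integral_increment]

/-- The Itô isometry for step functions. -/
lemma Step.variance_integral [IsProbabilityMeasure P] (hB : IsBrownianMotion B P) (φ : Step d) :
    Var[φ.integral B; P] = ∫ r, ‖φ.toFun r‖ ^ 2 ∂halfLine := by
  have hs : φ.integral B = ∑ l, φ.coordIntegral B l := by
    rw [φ.integral_eq_sum_coord B]; ext; simp
  rw [hs, IndepFun.variance_sum (fun l _ => (hB.hasGaussianLaw_coordIntegral φ l).memLp_two)
    fun i _ j _ hij => (φ.iIndepFun_coordIntegral hB).indepFun hij]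
  simp_rw [Step.variance_coordIntegral hB, EuclideanSpace.norm_sq_eq, Real.norm_eq_abs, sq_abs]
  rw [integral_finsetSum]
  intro l _
  exact (((EuclideanSpace.proj l : EuclideanSpace ℝ (Fin d) →L[ℝ] ℝ).comp_memLp'
    (φ.memLp_toFun 2)).integrable_sq)

lemma _root_.MeasureTheory.MemLp.eLpNorm_two_eq {α E : Type*} [MeasurableSpace α]
    [NormedAddCommGroup E] {μ : Measure α} {f : α → E} (hf : MemLp f 2 μ) :
    eLpNorm f 2 μ = ENNReal.ofReal (√(∫ x, ‖f x‖ ^ 2 ∂μ)) := by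
  rw [hf.eLpNorm_eq_integral_rpow_norm (by simp) (by simp)]
  simp [Real.sqrt_eq_rpow]

end Brownian

end Steps

/-! ### Convergence in `L²` -/

section LpConvergence

variable {α E : Type*} [MeasurableSpace α] [NormedAddCommGroup E] {μ : Measure α}

lemma tendsto_eLpNorm_sub_add {f g : ℕ → α → E} {f₀ g₀ : α → E}
    (hf : ∀ k, AEStronglyMeasurable (f k) μ) (hf₀ : AEStronglyMeasurable f₀ μ)
    (hg : ∀ k, AEStronglyMeasurable (g k) μ) (hg₀ : AEStronglyMeasurable g₀ μ)
    (h1 : Tendsto (fun k => eLpNorm (f k - f₀) 2 μ) atTop (𝓝 0))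
    (h2 : Tendsto (fun k => eLpNorm (g k - g₀) 2 μ) atTop (𝓝 0)) :
    Tendsto (fun k => eLpNorm ((f k + g k) - (f₀ + g₀)) 2 μ) atTop (𝓝 0) := by
  refine tendsto_of_tendsto_of_tendsto_of_le_of_le tendsto_const_nhds
    (by simpa using h1.add h2) (fun _ => zero_le) fun k => ?_
  dsimp only
  rw [add_sub_add_comm]
  exact eLpNorm_add_le ((hf k).sub hf₀) ((hg k).sub hg₀) one_le_two

lemma tendsto_eLpNorm_sub_const_smul [NormedSpace ℝ E] (a : ℝ) {f : ℕ → α → E} {f₀ : α → E}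
    (h : Tendsto (fun k => eLpNorm (f k - f₀) 2 μ) atTop (𝓝 0)) :
    Tendsto (fun k => eLpNorm (a • f k - a • f₀) 2 μ) atTop (𝓝 0) := by
  simp_rw [← smul_sub, eLpNorm_const_smul]
  simpa using ENNReal.Tendsto.const_mul h (Or.inr (by simp : ‖a‖ₑ ≠ ∞))

lemma tendsto_integral_norm_sq {f : ℕ → α → E} {f₀ : α → E}
    (hf : ∀ k, MemLp (f k) 2 μ) (hf₀ : MemLp f₀ 2 μ)
    (h : Tendsto (fun k => eLpNorm (f k - f₀) 2 μ) atTop (𝓝 0)) :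
    Tendsto (fun k => ∫ x, ‖f k x‖ ^ 2 ∂μ) atTop (𝓝 (∫ x, ‖f₀ x‖ ^ 2 ∂μ)) := by
  have key {g : α → E} (hg : MemLp g 2 μ) : ∫ x, ‖g x‖ ^ 2 ∂μ = ‖hg.toLp g‖ ^ 2 := by
    rw [Lp.norm_toLp, hg.eLpNorm_two_eq, ENNReal.toReal_ofReal (Real.sqrt_nonneg _),
      Real.sq_sqrt (by positivity)]
  rw [key hf₀]
  simp_rw [key (hf _)]
  exact (((Lp.tendsto_Lp_iff_tendsto_eLpNorm'' f hf f₀ hf₀).2 h).norm).pow 2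

lemma eLpNorm_two_eq_of_integral_eq {β F : Type*} [MeasurableSpace β] [NormedAddCommGroup F]
    {ν : Measure β} {f : α → E} {g : β → F} (hf : MemLp f 2 μ) (hg : MemLp g 2 ν)
    (h : ∫ x, ‖f x‖ ^ 2 ∂μ = ∫ x, ‖g x‖ ^ 2 ∂ν) : eLpNorm f 2 μ = eLpNorm g 2 ν := by
  rw [hf.eLpNorm_two_eq, hg.eLpNorm_two_eq, h]

lemma tendsto_integral_inner {E : Type*} [NormedAddCommGroup E] [InnerProductSpace ℝ E]
    {f : ℕ → α → E} {f₀ g : α → E} (hf : ∀ k, MemLp (f k) 2 μ) (hf₀ : MemLp f₀ 2 μ)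
    (hg : MemLp g 2 μ) (h : Tendsto (fun k => eLpNorm (f k - f₀) 2 μ) atTop (𝓝 0)) :
    Tendsto (fun k => ∫ x, inner ℝ (f k x) (g x) ∂μ) atTop (𝓝 (∫ x, inner ℝ (f₀ x) (g x) ∂μ)) := by
  have key {u : α → E} (hu : MemLp u 2 μ) :
      ∫ x, inner ℝ (u x) (g x) ∂μ = inner ℝ (hu.toLp u) (hg.toLp g) := by
    rw [L2.inner_def]
    refine integral_congr_ae ?_
    filter_upwards [hu.coeFn_toLp, hg.coeFn_toLp] with x h1 h2
    rw [h1, h2]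
  rw [key hf₀]
  simp_rw [key (hf _)]
  exact ((Lp.tendsto_Lp_iff_tendsto_eLpNorm'' f hf f₀ hf₀).2 h).inner tendsto_const_nhds

end LpConvergence

/-! ### The Wiener integral -/

section Wiener

variable {Ω : Type*} [MeasurableSpace Ω] {d m : ℕ}
variable {P : Measure Ω} {B : ℝ≥0 → Ω → EuclideanSpace ℝ (Fin d)}
variable {h h' : ℝ → EuclideanSpace ℝ (Fin d)} {Z Z' : Ω → ℝ}

lemma IsWienerIntegral.congr (hZ : IsWienerIntegral B P h Z) (e : h =ᵐ[halfLine] h')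
    (e' : Z =ᵐ[P] Z') : IsWienerIntegral B P h' Z' := by
  obtain ⟨m1, m2, φ, t1, t2⟩ := hZ
  refine ⟨m1.ae_eq e, m2.ae_eq e', φ, t1.congr fun k => ?_, t2.congr fun k => ?_⟩
  · exact eLpNorm_congr_ae ((ae_eq_refl _).sub e)
  · exact eLpNorm_congr_ae ((ae_eq_refl _).sub e')

variable (B P) in
lemma IsWienerIntegral.zero : IsWienerIntegral B P 0 0 := by
  let φ : Step d := ⟨0, Fin.elim0, Fin.elim0, fun k => k.elim0, Fin.elim0⟩
  have h1 : φ.toFun = 0 := by ext1 r; exact Finset.sum_empty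
  have h2 : φ.integral B = 0 := by ext1 r; exact Finset.sum_empty
  exact ⟨MemLp.zero, MemLp.zero, fun _ => φ, by simp [h1], by simp [h2]⟩

lemma IsWienerIntegral.add (hB : IsBrownianMotion B P) (hZ : IsWienerIntegral B P h Z)
    (hZ' : IsWienerIntegral B P h' Z') : IsWienerIntegral B P (h + h') (Z + Z') := by
  obtain ⟨m1, m2, φ, t1, t2⟩ := hZ
  obtain ⟨m1', m2', φ', t1', t2'⟩ := hZ'
  refine ⟨m1.add m1', m2.add m2', fun k => (φ k).add (φ' k), ?_, ?_⟩
  · simp_rw [Step.toFun_add]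
    exact tendsto_eLpNorm_sub_add (fun k => ((φ k).memLp_toFun 2).1) m1.1
      (fun k => ((φ' k).memLp_toFun 2).1) m1'.1 t1 t1'
  · simp_rw [Step.integral_add]
    exact tendsto_eLpNorm_sub_add (fun k => ((φ k).hasGaussianLaw_integral hB).memLp_two.1) m2.1
      (fun k => ((φ' k).hasGaussianLaw_integral hB).memLp_two.1) m2'.1 t2 t2'

lemma IsWienerIntegral.smul (a : ℝ) (hZ : IsWienerIntegral B P h Z) :
    IsWienerIntegral B P (a • h) (a • Z) := by
  obtain ⟨m1, m2, φ, t1, t2⟩ := hZ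
  refine ⟨m1.const_smul a, m2.const_smul a, fun k => (φ k).smul a, ?_, ?_⟩
  · simp_rw [Step.toFun_smul]
    exact tendsto_eLpNorm_sub_const_smul a t1
  · simp_rw [Step.integral_smul]
    exact tendsto_eLpNorm_sub_const_smul a t2

lemma IsWienerIntegral.sub (hB : IsBrownianMotion B P) (hZ : IsWienerIntegral B P h Z)
    (hZ' : IsWienerIntegral B P h' Z') : IsWienerIntegral B P (h - h') (Z - Z') := by
  simpa [sub_eq_add_neg] using hZ.add hB (hZ'.smul (-1))

lemma IsWienerIntegral.sum (hB : IsBrownianMotion B P) {ι : Type*} (s : Finset ι)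
    {g : ι → ℝ → EuclideanSpace ℝ (Fin d)} {V : ι → Ω → ℝ}
    (hV : ∀ i ∈ s, IsWienerIntegral B P (g i) (V i)) :
    IsWienerIntegral B P (∑ i ∈ s, g i) (∑ i ∈ s, V i) := by
  classical
  induction s using Finset.induction_on with
  | empty => simpa using IsWienerIntegral.zero P B
  | insert a s ha ih =>
    rw [Finset.sum_insert ha, Finset.sum_insert ha]
    exact (hV a (by simp)).add hB (ih fun i hi => hV i (by simp [hi]))

lemma _root_.EuclideanSpace.apply_eq_sum_single {n : ℕ}
    (L : StrongDual ℝ (EuclideanSpace ℝ (Fin n))) (x : EuclideanSpace ℝ (Fin n)) :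
    L x = ∑ i, L (EuclideanSpace.single i 1) * x i := by
  conv_lhs => rw [← (EuclideanSpace.basisFun (Fin n) ℝ).sum_repr x]
  simp [mul_comm]

/-- Continuous linear functionals of a vector of Wiener integrals are Wiener integrals. -/
lemma IsWienerIntegral.dual (hB : IsBrownianMotion B P) {n : ℕ}
    {g : Fin n → ℝ → EuclideanSpace ℝ (Fin d)} {W : Ω → EuclideanSpace ℝ (Fin n)}
    (hW : ∀ i, IsWienerIntegral B P (g i) (fun ω => W ω i))
    (L : StrongDual ℝ (EuclideanSpace ℝ (Fin n))) :
    IsWienerIntegral B P (fun r => ∑ i, L (EuclideanSpace.single i 1) • g i r)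
      (fun ω => L (W ω)) := by
  have := IsWienerIntegral.sum hB Finset.univ
    fun i _ => (hW i).smul (L (EuclideanSpace.single i 1))
  convert this using 1
  · ext1 r; simp
  · ext1 ω
    rw [EuclideanSpace.apply_eq_sum_single]
    simp

variable [IsProbabilityMeasure P]

/-- The Itô isometry. -/
lemma IsWienerIntegral.integral_sq (hB : IsBrownianMotion B P) (hZ : IsWienerIntegral B P h Z) :
    ∫ ω, Z ω ^ 2 ∂P = ∫ r, ‖h r‖ ^ 2 ∂halfLine := by
  obtain ⟨m1, m2, φ, t1, t2⟩ := hZ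
  have hG (k) := (φ k).hasGaussianLaw_integral hB
  have l1 := tendsto_integral_norm_sq (fun k => (φ k).memLp_toFun 2) m1 t1
  have l2 := tendsto_integral_norm_sq (fun k => (hG k).memLp_two) m2 t2
  simp_rw [← (φ _).variance_integral hB, variance_of_integral_eq_zero (hG _).aemeasurable
    ((φ _).integral_integral hB)] at l1
  simp only [Real.norm_eq_abs, sq_abs] at l2
  exact tendsto_nhds_unique l2 l1

lemma IsWienerIntegral.eLpNorm_eq (hB : IsBrownianMotion B P) (hZ : IsWienerIntegral B P h Z) :
    eLpNorm Z 2 P = eLpNorm h 2 halfLine :=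
  eLpNorm_two_eq_of_integral_eq hZ.2.1 hZ.1 (by simpa using hZ.integral_sq hB)

lemma IsWienerIntegral.integral_mul (hB : IsBrownianMotion B P) (hZ : IsWienerIntegral B P h Z)
    (hZ' : IsWienerIntegral B P h' Z') :
    ∫ ω, Z ω * Z' ω ∂P = ∫ r, inner ℝ (h r) (h' r) ∂halfLine := by
  have a := (hZ.add hB hZ').integral_sq hB
  have b := (hZ.sub hB hZ').integral_sq hB
  have e1 : ∫ ω, Z ω * Z' ω ∂P =
      (∫ ω, (Z + Z') ω ^ 2 ∂P - ∫ ω, (Z - Z') ω ^ 2 ∂P) / 4 := by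
    rw [← integral_sub (hZ.2.1.add hZ'.2.1).integrable_sq (hZ.2.1.sub hZ'.2.1).integrable_sq,
      ← integral_div]
    congr 1 with ω
    simp only [Pi.add_apply, Pi.sub_apply]
    ring
  have e2 : ∫ r, inner ℝ (h r) (h' r) ∂halfLine =
      (∫ r, ‖(h + h') r‖ ^ 2 ∂halfLine - ∫ r, ‖(h - h') r‖ ^ 2 ∂halfLine) / 4 := by
    rw [← integral_sub ((memLp_two_iff_integrable_sq_norm (hZ.1.add hZ'.1).1).1 (hZ.1.add hZ'.1))
      ((memLp_two_iff_integrable_sq_norm (hZ.1.sub hZ'.1).1).1 (hZ.1.sub hZ'.1)),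
      ← integral_div]
    congr 1 with r
    simp only [Pi.add_apply, Pi.sub_apply, norm_add_sq_real, norm_sub_sq_real]
    ring
  rw [e1, e2, a, b]

/-- The space of Wiener integrals is closed: if the integrands converge in `H` and their integrals
converge almost surely, then the limit is the integral of the limit. By Fatou's lemma and the
isometry, almost sure convergence can be upgraded to convergence in `L²(Ω)`. -/
lemma IsWienerIntegral.of_tendsto_ae (hB : IsBrownianMotion B P)
    {g : ℕ → ℝ → EuclideanSpace ℝ (Fin d)} {V : ℕ → Ω → ℝ}
    (hV : ∀ k, IsWienerIntegral B P (g k) (V k)) (hh : MemLp h 2 halfLine)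
    (hg : Tendsto (fun k => eLpNorm (g k - h) 2 halfLine) atTop (𝓝 0))
    (hZ : AEStronglyMeasurable Z P)
    (hVZ : ∀ᵐ ω ∂P, Tendsto (fun k => V k ω) atTop (𝓝 (Z ω))) : IsWienerIntegral B P h Z := by
  have bound (k : ℕ) : eLpNorm (V k - Z) 2 P ≤ eLpNorm (g k - h) 2 halfLine := by
    have l1 := Lp.eLpNorm_lim_le_liminf_eLpNorm (p := 2)
      (fun n => (hV k).2.1.1.sub (hV n).2.1.1) (V k - Z)
      (by filter_upwards [hVZ] with ω hω using tendsto_const_nhds.sub hω)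
    refine l1.trans ?_
    simp_rw [((hV k).sub hB (hV _)).eLpNorm_eq hB]
    have l2 : Tendsto (fun n => eLpNorm (g k - h) 2 halfLine + eLpNorm (g n - h) 2 halfLine)
        atTop (𝓝 (eLpNorm (g k - h) 2 halfLine)) := by
      simpa using tendsto_const_nhds.add hg
    rw [← l2.liminf_eq]
    refine liminf_le_liminf (Eventually.of_forall fun n => ?_)
    have : g k - g n = (g k - h) - (g n - h) := by abel
    rw [this]
    exact eLpNorm_sub_le ((hV k).1.1.sub hh.1) ((hV n).1.1.sub hh.1) one_le_two
  have hconv : Tendsto (fun k => eLpNorm (V k - Z) 2 P) atTop (𝓝 0) :=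
    tendsto_of_tendsto_of_tendsto_of_le_of_le tendsto_const_nhds hg (fun _ => zero_le) bound
  have hZ2 : MemLp Z 2 P := by
    have := (hV 0).2.1.sub (⟨(hV 0).2.1.1.sub hZ,
      (bound 0).trans_lt ((hV 0).1.sub hh).2⟩ : MemLp (V 0 - Z) 2 P)
    simpa using this
  -- A step function close to each `g k`, with elementary integral close to `V k`.
  have hφ (k : ℕ) : ∃ φ : Step d, eLpNorm (φ.toFun - g k) 2 halfLine ≤ ((k : ℝ≥0∞) + 1)⁻¹ ∧
      eLpNorm (φ.integral B - V k) 2 P ≤ ((k : ℝ≥0∞) + 1)⁻¹ := by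
    obtain ⟨-, -, φ, t1, t2⟩ := hV k
    have hpos : (0 : ℝ≥0∞) < ((k : ℝ≥0∞) + 1)⁻¹ := by simp
    obtain ⟨n, h1, h2⟩ := ((t1.eventually (ge_mem_nhds hpos)).and
      (t2.eventually (ge_mem_nhds hpos))).exists
    exact ⟨φ n, h1, h2⟩
  choose φ h1 h2 using hφ
  have hinv : Tendsto (fun k : ℕ => ((k : ℝ≥0∞) + 1)⁻¹) atTop (𝓝 0) := by
    have := (tendsto_add_atTop_iff_nat 1).2 ENNReal.tendsto_inv_nat_nhds_zero
    simpa using this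
  refine ⟨hh, hZ2, φ, ?_, ?_⟩
  · refine tendsto_of_tendsto_of_tendsto_of_le_of_le tendsto_const_nhds
      (by simpa using hinv.add hg) (fun _ => zero_le) fun k => ?_
    have : (φ k).toFun - h = ((φ k).toFun - g k) + (g k - h) := by abel
    dsimp only
    rw [this]
    exact (eLpNorm_add_le (((φ k).memLp_toFun 2).1.sub (hV k).1.1) ((hV k).1.1.sub hh.1)
      one_le_two).trans (add_le_add (h1 k) le_rfl)
  · refine tendsto_of_tendsto_of_tendsto_of_le_of_le tendsto_const_nhds
      (by simpa using hinv.add hconv) (fun _ => zero_le) fun k => ?_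
    have : (φ k).integral B - Z = ((φ k).integral B - V k) + (V k - Z) := by abel
    dsimp only
    rw [this]
    exact (eLpNorm_add_le (((φ k).hasGaussianLaw_integral hB).memLp_two.1.sub (hV k).2.1.1)
      ((hV k).2.1.1.sub hZ) one_le_two).trans (add_le_add (h2 k) le_rfl)

/-- A Wiener integral is a centred Gaussian variable, since characteristic functions pass to the
limit. -/
lemma IsWienerIntegral.map_eq (hB : IsBrownianMotion B P) (hZ : IsWienerIntegral B P h Z) :
    P.map Z = gaussianReal 0 (∫ r, ‖h r‖ ^ 2 ∂halfLine).toNNReal := by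
  obtain ⟨m1, m2, φ, t1, t2⟩ := hZ
  have hG (k) := (φ k).hasGaussianLaw_integral hB
  have l1 := tendsto_integral_norm_sq (fun k => (φ k).memLp_toFun 2) m1 t1
  obtain ⟨ns, hns, hlim⟩ := (tendstoInMeasure_of_tendsto_eLpNorm two_ne_zero
    (fun k => (hG k).memLp_two.1) m2.1 t2).exists_seq_tendsto_ae
  have hprob : IsProbabilityMeasure (P.map Z) := Measure.isProbabilityMeasure_map m2.1.aemeasurable
  refine Measure.ext_of_charFun (funext fun t => ?_)
  have key {V : Ω → ℝ} (hV : AEMeasurable V P) :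
      charFun (P.map V) t = ∫ ω, Complex.exp (t * V ω * Complex.I) ∂P := by
    rw [charFun_apply_real, integral_map hV (by fun_prop)]
  have c1 : Tendsto (fun k => charFun (P.map ((φ (ns k)).integral B)) t) atTop
      (𝓝 (charFun (P.map Z) t)) := by
    rw [key m2.1.aemeasurable]
    simp_rw [key (hG _).aemeasurable]
    refine tendsto_integral_of_dominated_convergence (fun _ => 1) (fun k => ?_)
      (integrable_const _) (fun k => ae_of_all _ fun ω => ?_) ?_
    · have := (hG (ns k)).aemeasurable
      exact AEMeasurable.aestronglyMeasurable (by fun_prop)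
    · rw [← Complex.ofReal_mul, Complex.norm_exp_ofReal_mul_I]
    · filter_upwards [hlim] with ω hω
      have hc : Continuous fun x : ℝ => Complex.exp (t * x * Complex.I) := by fun_prop
      exact (hc.tendsto _).comp hω
  refine tendsto_nhds_unique c1 ?_
  simp_rw [(hG _).map_eq_gaussianReal, (φ _).integral_integral hB, (φ _).variance_integral hB,
    charFun_gaussianReal]
  have hc : Continuous fun v : ℝ => Complex.exp (t * (0 : ℝ) * Complex.I -
    ((v.toNNReal : ℝ) : ℂ) * t ^ 2 / 2) := by fun_prop
  exact (hc.tendsto _).comp (l1.comp hns.tendsto_atTop)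

lemma IsWienerIntegral.hasGaussianLaw (hB : IsBrownianMotion B P)
    (hZ : IsWienerIntegral B P h Z) : HasGaussianLaw Z P :=
  ⟨by rw [hZ.map_eq hB]; infer_instance⟩

lemma IsWienerIntegral.integral_eq_zero (hB : IsBrownianMotion B P)
    (hZ : IsWienerIntegral B P h Z) : ∫ ω, Z ω ∂P = 0 := by
  have := integral_id_gaussianReal (μ := 0) (v := (∫ r, ‖h r‖ ^ 2 ∂halfLine).toNNReal)
  rwa [← hZ.map_eq hB, integral_map hZ.2.1.1.aemeasurable (by fun_prop)] at this

lemma IsWienerIntegral.covariance_eq (hB : IsBrownianMotion B P) (hZ : IsWienerIntegral B P h Z)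
    (hZ' : IsWienerIntegral B P h' Z') :
    cov[Z, Z'; P] = ∫ r, inner ℝ (h r) (h' r) ∂halfLine := by
  rw [covariance_eq_sub hZ.2.1 hZ'.2.1, hZ.integral_eq_zero hB, zero_mul, sub_zero,
    ← hZ.integral_mul hB hZ']
  rfl

end Wiener

/-! ### Gaussian integration by parts -/

section GaussianIBP

variable {Ω : Type*} [MeasurableSpace Ω] {P : Measure Ω}
variable {E F : Type*} [NormedAddCommGroup E] [NormedSpace ℝ E]
variable [NormedAddCommGroup F] [NormedSpace ℝ F]

lemma _root_.Function.HasTemperateGrowth.fderiv {f : E → F} (hf : f.HasTemperateGrowth) :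
    (fderiv ℝ f).HasTemperateGrowth := by
  refine ⟨(contDiff_infty_iff_fderiv.1 hf.1).2, fun n => ?_⟩
  obtain ⟨k, C, h⟩ := hf.2 (n + 1)
  exact ⟨k, C, fun x => by rw [norm_iteratedFDeriv_fderiv]; exact h x⟩

lemma _root_.Function.HasTemperateGrowth.fderiv_apply {f : E → F} (hf : f.HasTemperateGrowth)
    (a : E) : (fun x => fderiv ℝ f x a).HasTemperateGrowth :=
  (ContinuousLinearMap.apply ℝ F a).hasTemperateGrowth.comp hf.fderiv

lemma _root_.Function.HasTemperateGrowth.differentiable {f : E → F} (hf : f.HasTemperateGrowth) :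
    Differentiable ℝ f := (contDiff_infty_iff_fderiv.1 hf.1).1

lemma memLp_pow_of_forall_memLp {g : Ω → ℝ} [IsFiniteMeasure P]
    (hg : ∀ p : ℝ≥0∞, p ≠ ∞ → MemLp g p P) (k : ℕ) :
    ∀ p : ℝ≥0∞, p ≠ ∞ → MemLp (fun ω => g ω ^ k) p P := by
  induction k with
  | zero => intro p _; simpa using memLp_const 1
  | succ k ih =>
    intro p hp
    have h2 : (2 * p : ℝ≥0∞) ≠ ∞ := ENNReal.mul_ne_top (by simp) hp
    have : ENNReal.HolderTriple (2 * p) (2 * p) p := ⟨by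
      rw [← two_mul, ENNReal.mul_inv (by simp) (by simp), ← mul_assoc,
        ENNReal.mul_inv_cancel (by simp) (by simp), one_mul]⟩
    simp_rw [pow_succ]
    exact (hg _ h2).mul (ih _ h2)

variable [CompleteSpace E] [SecondCountableTopology E] [MeasurableSpace E] [BorelSpace E]

/-- A functional of temperate growth of a Gaussian vector has moments of all orders. -/
lemma _root_.ProbabilityTheory.HasGaussianLaw.memLp_comp {W : Ω → E}
    (hW : HasGaussianLaw W P) {f : E → ℝ}
    (hf : f.HasTemperateGrowth) {p : ℝ≥0∞} (hp : p ≠ ∞) : MemLp (fun ω => f (W ω)) p P := by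
  have := hW.isProbabilityMeasure
  obtain ⟨k, C, h⟩ := hf.2 0
  have h1 (q : ℝ≥0∞) (hq : q ≠ ∞) : MemLp (fun ω => 1 + ‖W ω‖) q P :=
    (memLp_const (1 : ℝ)).add (hW.memLp hq).norm
  have hm : AEStronglyMeasurable (fun ω => f (W ω)) P :=
    (hf.1.continuous.measurable.comp_aemeasurable hW.aemeasurable).aestronglyMeasurable
  refine ((memLp_pow_of_forall_memLp h1 k p hp).const_mul C).mono hm (ae_of_all _ fun ω => ?_)
  have := h (W ω)
  rw [norm_iteratedFDeriv_zero] at this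
  exact this.trans (le_abs_self _)

lemma hasDerivAt_gaussianPDFReal_zero (v : ℝ≥0) (x : ℝ) :
    HasDerivAt (gaussianPDFReal 0 v) (-(x / v) * gaussianPDFReal 0 v x) x := by
  unfold gaussianPDFReal
  have h1 : HasDerivAt (fun y : ℝ => -(y - 0) ^ 2 / (2 * v)) (-(x / v)) x := by
    have := ((((hasDerivAt_id x).sub_const 0).pow 2).neg).div_const (2 * (v : ℝ))
    refine this.congr_deriv ?_
    simp only [id, sub_zero]
    rw [← mul_div_mul_left x (v : ℝ) two_ne_zero]
    push_cast
    ring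
  refine (h1.exp.const_mul _).congr_deriv ?_
  ring

/-- Stein's identity for a centred Gaussian measure on the line. -/
lemma integral_mul_id_gaussianReal {v : ℝ≥0} (hv : v ≠ 0) {g : ℝ → ℝ}
    (hg : g.HasTemperateGrowth) :
    ∫ x, g x * x ∂gaussianReal 0 v = v * ∫ x, deriv g x ∂gaussianReal 0 v := by
  have hid : HasGaussianLaw (fun x : ℝ => x) (gaussianReal 0 v) := IsGaussian.hasGaussianLaw_id
  have int {u : ℝ → ℝ} (hu : u.HasTemperateGrowth) :
      Integrable (fun x => gaussianPDFReal 0 v x * u x) := by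
    have h1 : Integrable u (gaussianReal 0 v) :=
      memLp_one_iff_integrable.1 (hid.memLp_comp hu (by simp))
    rw [gaussianReal_of_var_ne_zero _ hv, integrable_withDensity_iff_integrable_smul'
      (measurable_gaussianPDF _ _) (ae_of_all _ fun _ => gaussianPDF_lt_top)] at h1
    simpa [toReal_gaussianPDF] using h1
  have hd : (deriv g).HasTemperateGrowth := by
    have := hg.fderiv_apply 1
    simpa using this
  have hgx : (fun x => g x * x).HasTemperateGrowth := by fun_prop
  have hderiv (x : ℝ) : HasDerivAt (fun y => gaussianPDFReal 0 v y * g y)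
      (gaussianPDFReal 0 v x * deriv g x - (v : ℝ)⁻¹ * (gaussianPDFReal 0 v x * (g x * x))) x := by
    refine ((hasDerivAt_gaussianPDFReal_zero v x).mul
      (hg.differentiable x).hasDerivAt).congr_deriv ?_
    ring
  have h0 := integral_eq_zero_of_hasDerivAt_of_integrable hderiv
    ((int hd).sub ((int hgx).const_mul _)) (int hg)
  rw [integral_sub (int hd) ((int hgx).const_mul _), integral_const_mul] at h0
  rw [integral_gaussianReal_eq_integral_smul hv, integral_gaussianReal_eq_integral_smul hv]
  simp only [smul_eq_mul]
  rw [sub_eq_zero.1 h0]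
  field_simp

/-- Gaussian integration by parts: if `(W, ξ)` is jointly Gaussian, `ξ` is centred with variance
`v`, and `a` is the covariance of `W` and `ξ`, then `E[f(W) ξ] = E[∂ₐ f(W)]`. The vector
`R = W - (ξ / v) a` is independent of `ξ`, which reduces the claim to Stein's identity in the
variable `ξ` alone. -/
lemma _root_.ProbabilityTheory.HasGaussianLaw.integral_comp_mul_eq_integral_fderiv
    {W : Ω → E} {ξ : Ω → ℝ} {v : ℝ≥0}
    (hWξ : HasGaussianLaw (fun ω => (W ω, ξ ω)) P) (hξ : P.map ξ = gaussianReal 0 v) {a : E}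
    (ha : ∀ L : StrongDual ℝ E, cov[fun ω => L (W ω), ξ; P] = L a) {f : E → ℝ}
    (hf : f.HasTemperateGrowth) :
    ∫ ω, f (W ω) * ξ ω ∂P = ∫ ω, fderiv ℝ f (W ω) a ∂P := by
  have hP := hWξ.isProbabilityMeasure
  have hξ2 : MemLp ξ 2 P := hWξ.snd.memLp_two
  have hW2 : MemLp W 2 P := hWξ.fst.memLp_two
  have hmξ := hWξ.snd.aemeasurable
  have hLW (L : StrongDual ℝ E) : MemLp (fun ω => L (W ω)) 2 P := L.comp_memLp' hW2
  -- If `v = 0`, then `ξ = 0` almost surely and `a = 0`.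
  rcases eq_or_ne v 0 with rfl | hv
  · have h0 : ξ =ᵐ[P] fun _ => 0 :=
      HasLaw.ae_eq_of_dirac ⟨hmξ, by rw [hξ, gaussianReal_zero_var]⟩
    have ha0 : a = 0 := by
      refine SeparatingDual.eq_zero_of_forall_dual_eq_zero (R := ℝ) fun L => ?_
      rw [← ha L, covariance_eq_sub (hLW L) hξ2, integral_congr_ae h0,
        integral_congr_ae (g := fun _ => 0) (by filter_upwards [h0] with ω hω; simp [hω])]
      simp
    subst ha0
    rw [integral_congr_ae (g := fun _ => 0) (by filter_upwards [h0] with ω hω; simp [hω])]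
    simp
  have hv' : (v : ℝ) ≠ 0 := by simpa using hv
  have hvar : cov[ξ, ξ; P] = v := by
    rw [covariance_self hmξ]
    have := variance_id_gaussianReal (μ := 0) (v := v)
    rwa [← hξ, variance_map (by fun_prop) hmξ] at this
  set c : E := (v : ℝ)⁻¹ • a with hc
  set R : Ω → E := fun ω => W ω - ξ ω • c with hR
  have hRξ : HasGaussianLaw (fun ω => (R ω, ξ ω)) P := by
    let L : E × ℝ →L[ℝ] E × ℝ := (ContinuousLinearMap.fst ℝ E ℝ -
      (ContinuousLinearMap.snd ℝ E ℝ).smulRight c).prod (ContinuousLinearMap.snd ℝ E ℝ)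
    exact (hWξ.map L).congr (ae_of_all _ fun ω => by simp [L, R])
  have hind : IndepFun R ξ P := by
    refine hRξ.indepFun_of_covariance_strongDual fun L₁ L₂ => ?_
    have e1 : L₁ ∘ R = fun ω => L₁ (W ω) - L₁ c * ξ ω := by
      ext1 ω; simp [R, mul_comm]
    have e2 : L₂ ∘ ξ = fun ω => L₂ 1 * ξ ω := by
      ext1 ω
      have := L₂.map_smul (ξ ω) 1
      simpa [mul_comm] using this
    rw [e1, e2, covariance_const_mul_right,
      covariance_fun_sub_left (hLW L₁) (hξ2.const_mul _) hξ2,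
      covariance_const_mul_left, ha, hvar, hc, map_smul, smul_eq_mul]
    field_simp
    simp
  have hmR := hRξ.fst.aemeasurable
  have hlaw : P.map (fun ω => (R ω, ξ ω)) = (P.map R).prod (gaussianReal 0 v) := by
    rw [(indepFun_iff_map_prod_eq_prod_map_map hmR hmξ).1 hind, hξ]
  have hprobR : IsProbabilityMeasure (P.map R) := Measure.isProbabilityMeasure_map hmR
  have hWR (ω) : W ω = R ω + ξ ω • c := by simp [R]
  have hΦ : (fun p : E × ℝ => p.1 + p.2 • c).HasTemperateGrowth :=
    ((ContinuousLinearMap.fst ℝ E ℝ) +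
      (ContinuousLinearMap.snd ℝ E ℝ).smulRight c).hasTemperateGrowth
  have fub {u : E × ℝ → ℝ} (hu : u.HasTemperateGrowth) :
      ∫ ω, u (R ω, ξ ω) ∂P = ∫ r, ∫ x, u (r, x) ∂gaussianReal 0 v ∂(P.map R) := by
    have hm : AEMeasurable (fun ω => (R ω, ξ ω)) P := hmR.prodMk hmξ
    have hint : Integrable u (P.map fun ω => (R ω, ξ ω)) := by
      rw [integrable_map_measure hu.1.continuous.aestronglyMeasurable hm]
      exact memLp_one_iff_integrable.1 (hRξ.memLp_comp hu (by simp))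
    rw [hlaw] at hint
    rw [← integral_prod _ hint, ← hlaw, integral_map hm hu.1.continuous.aestronglyMeasurable]
  have h1 : (fun p : E × ℝ => f (p.1 + p.2 • c) * p.2).HasTemperateGrowth :=
    (hf.comp hΦ).mul (ContinuousLinearMap.snd ℝ E ℝ).hasTemperateGrowth
  have h2 : (fun p : E × ℝ => fderiv ℝ f (p.1 + p.2 • c) a).HasTemperateGrowth :=
    (hf.fderiv_apply a).comp hΦ
  simp_rw [hWR]
  rw [fub h1, fub h2]
  congr 1 with r
  -- Stein's identity on the line through `r` in the direction `c = a / v`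
  have hline : (fun x : ℝ => r + x • c).HasTemperateGrowth :=
    (Function.HasTemperateGrowth.const r).add
      (ContinuousLinearMap.smulRight (1 : ℝ →L[ℝ] ℝ) c).hasTemperateGrowth
  have hd (x : ℝ) : deriv (fun y : ℝ => f (r + y • c)) x = fderiv ℝ f (r + x • c) c := by
    have e1 : HasDerivAt (fun y : ℝ => r + y • c) c x := by
      simpa using ((hasDerivAt_id x).smul_const c).const_add r
    exact ((hf.differentiable _).hasFDerivAt.comp_hasDerivAt x e1).deriv
  refine (integral_mul_id_gaussianReal hv (g := fun x => f (r + x • c)) (hf.comp hline)).trans ?_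
  simp_rw [hd, ← integral_const_mul]
  congr 1 with x
  rw [hc, map_smul, smul_eq_mul, mul_inv_cancel_left₀ hv']

end GaussianIBP

/-! ### Closability of the Malliavin derivative -/

section Closability

variable {Ω : Type*} [MeasurableSpace Ω] {d m : ℕ}
variable {P : Measure Ω} {B : ℝ≥0 → Ω → EuclideanSpace ℝ (Fin d)}

lemma integrable_inner_of_memLp {α E : Type*} [MeasurableSpace α] [NormedAddCommGroup E]
    [InnerProductSpace ℝ E] {μ : Measure α} {f g : α → E} (hf : MemLp f 2 μ) (hg : MemLp g 2 μ) :
    Integrable (fun x => (inner ℝ (f x) (g x) : ℝ)) μ := by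
  refine (L2.integrable_inner (𝕜 := ℝ) (hf.toLp f) (hg.toLp g)).congr ?_
  filter_upwards [hf.coeFn_toLp, hg.coeFn_toLp] with x h1 h2
  rw [h1, h2]

lemma memLp_two_smul_prod {α β E : Type*} [MeasurableSpace α] [MeasurableSpace β]
    [NormedAddCommGroup E] [NormedSpace ℝ E] {μ : Measure α} {ν : Measure β} [SFinite μ] [SFinite ν]
    {g : α → ℝ} {h : β → E} (hg : MemLp g 2 μ) (hh : MemLp h 2 ν) :
    MemLp (fun p : α × β => g p.1 • h p.2) 2 (μ.prod ν) := by
  have hm : AEStronglyMeasurable (fun p : α × β => g p.1 • h p.2) (μ.prod ν) :=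
    hg.1.comp_fst.smul hh.1.comp_snd
  rw [memLp_two_iff_integrable_sq_norm hm]
  have := ((memLp_two_iff_integrable_sq_norm hg.1).1 hg).mul_prod
    ((memLp_two_iff_integrable_sq_norm hh.1).1 hh)
  simpa [norm_smul, mul_pow] using this

/-- The vector of inner products `⟨hᵢ, k⟩_H`, which is the covariance of `(B(h₁), …, B(hₙ))`
and `B(k)`. -/
noncomputable def gramVector {n : ℕ} (h : Fin n → ℝ → EuclideanSpace ℝ (Fin d))
    (k : ℝ → EuclideanSpace ℝ (Fin d)) : EuclideanSpace ℝ (Fin n) :=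
  WithLp.toLp 2 fun i => ∫ r, inner ℝ (h i r) (k r) ∂halfLine

variable {n n' : ℕ} {h : Fin n → ℝ → EuclideanSpace ℝ (Fin d)} {W : Ω → EuclideanSpace ℝ (Fin n)}
variable {h' : Fin n' → ℝ → EuclideanSpace ℝ (Fin d)} {W' : Ω → EuclideanSpace ℝ (Fin n')}
variable {k : ℝ → EuclideanSpace ℝ (Fin d)} {ξ : Ω → ℝ}

lemma hasGaussianLaw_of_forall_dual {E : Type*} [NormedAddCommGroup E] [NormedSpace ℝ E]
    [MeasurableSpace E] [BorelSpace E] {V : Ω → E} (hV : AEMeasurable V P)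
    (h : ∀ L : StrongDual ℝ E, HasGaussianLaw (fun ω => L (V ω)) P) : HasGaussianLaw V P := by
  refine ⟨isGaussian_of_isGaussian_map fun L => ?_⟩
  rw [AEMeasurable.map_map_of_aemeasurable (by fun_prop) hV]
  exact (h L).isGaussian_map

lemma aemeasurable_of_forall_isWienerIntegral
    (hW : ∀ i, IsWienerIntegral B P (h i) (fun ω => W ω i)) : AEMeasurable W P := by
  have h1 : AEMeasurable (fun ω i => W ω i) P :=
    aemeasurable_pi_lambda _ fun i => (hW i).2.1.1.aemeasurable
  exact (WithLp.measurable_toLp 2 (Fin n → ℝ)).comp_aemeasurable h1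

variable [IsProbabilityMeasure P]

lemma covariance_dual (hB : IsBrownianMotion B P)
    (hW : ∀ i, IsWienerIntegral B P (h i) (fun ω => W ω i)) (hξ : IsWienerIntegral B P k ξ)
    (L : StrongDual ℝ (EuclideanSpace ℝ (Fin n))) :
    cov[fun ω => L (W ω), ξ; P] = L (gramVector h k) := by
  rw [(IsWienerIntegral.dual hB hW L).covariance_eq hB hξ, EuclideanSpace.apply_eq_sum_single]
  simp_rw [sum_inner, real_inner_smul_left]
  rw [integral_finsetSum _ fun i _ => (integrable_inner_of_memLp (hW i).1 hξ.1).const_mul _]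
  simp_rw [integral_const_mul]
  rfl

/-- Wiener integrals are jointly Gaussian, because every linear combination of them is a Wiener
integral. -/
lemma hasGaussianLaw_prodMk_prodMk (hB : IsBrownianMotion B P)
    (hW : ∀ i, IsWienerIntegral B P (h i) (fun ω => W ω i))
    (hW' : ∀ i, IsWienerIntegral B P (h' i) (fun ω => W' ω i)) (hξ : IsWienerIntegral B P k ξ) :
    HasGaussianLaw (fun ω => ((W ω, W' ω), ξ ω)) P := by
  refine hasGaussianLaw_of_forall_dual
    (((aemeasurable_of_forall_isWienerIntegral hW).prodMk
      (aemeasurable_of_forall_isWienerIntegral hW')).prodMk hξ.2.1.1.aemeasurable) fun L => ?_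
  let E := EuclideanSpace ℝ (Fin n) × EuclideanSpace ℝ (Fin n')
  let L₁ := (L.comp (.inl ℝ E ℝ)).comp (.inl ℝ (EuclideanSpace ℝ (Fin n)) _)
  let L₂ := (L.comp (.inl ℝ E ℝ)).comp (.inr ℝ _ (EuclideanSpace ℝ (Fin n')))
  have key := (((IsWienerIntegral.dual hB hW L₁).add hB (IsWienerIntegral.dual hB hW' L₂)).add hB
    (hξ.smul (L ((0, 0), 1)))).hasGaussianLaw hB
  refine key.congr (ae_of_all _ fun ω => ?_)
  have e : ((W ω, W' ω), ξ ω) = ((W ω, 0), 0) + ((0, W' ω), 0) + ξ ω • (((0, 0), 1) : E × ℝ) := by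
    simp
  dsimp only
  rw [e, map_add, map_add, map_smul]
  simp [L₁, L₂, mul_comm, E]

/-- Integration by parts on smooth cylindrical functionals:
`E[φ ⟨DF, k⟩_H] = E[F (φ B(k) - ⟨Dφ, k⟩_H)]`. -/
lemma IsCylindricalPair.integral_inner_eq (hB : IsBrownianMotion B P) {F : Ω → ℝ}
    {G : Ω → ℝ → EuclideanSpace ℝ (Fin d)} (hFG : IsCylindricalPair B P F G)
    (hW' : ∀ i, IsWienerIntegral B P (h' i) (fun ω => W' ω i)) (hξ : IsWienerIntegral B P k ξ)
    {φ : EuclideanSpace ℝ (Fin n') → ℝ} (hφ : φ.HasTemperateGrowth) :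
    ∫ p, inner ℝ (Function.uncurry G p) (φ (W' p.1) • k p.2) ∂(P.prod halfLine) =
      ∫ ω, F ω * (φ (W' ω) * ξ ω - fderiv ℝ φ (W' ω) (gramVector h' k)) ∂P := by
  obtain ⟨n, f, h, W, hf, hW, rfl, rfl⟩ := hFG
  set a := gramVector h k with ha
  set a' := gramVector h' k with ha'
  have hG := hasGaussianLaw_prodMk_prodMk hB hW hW' hξ
  have hGW := hG.fst.fst
  have hGW' := hG.fst.snd
  -- the left-hand side is `E[φ(W') ∂ₐ f(W)]`
  have lhs : ∫ p, inner ℝ (Function.uncurry (fun ω r => ∑ i, fderiv ℝ f (W ω)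
      (EuclideanSpace.single i 1) • h i r) p) (φ (W' p.1) • k p.2) ∂(P.prod halfLine) =
      ∫ ω, φ (W' ω) * fderiv ℝ f (W ω) a ∂P := by
    have hi (i) : Integrable (fun ω => φ (W' ω) * fderiv ℝ f (W ω) (EuclideanSpace.single i 1)) P :=
      (hGW'.memLp_comp hφ (p := 2) (by simp)).integrable_mul
        (hGW.memLp_comp (hf.fderiv_apply _) (p := 2) (by simp))
    have e1 (p : Ω × ℝ) : (inner ℝ (Function.uncurry (fun ω r => ∑ i, fderiv ℝ f (W ω)
        (EuclideanSpace.single i 1) • h i r) p) (φ (W' p.1) • k p.2) : ℝ) =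
        ∑ i, (φ (W' p.1) * fderiv ℝ f (W p.1) (EuclideanSpace.single i 1)) *
          inner ℝ (h i p.2) (k p.2) := by
      simp only [Function.uncurry, sum_inner, real_inner_smul_left, real_inner_smul_right]
      exact Finset.sum_congr rfl fun i _ => by ring
    simp_rw [e1]
    rw [integral_finsetSum _ fun i _ =>
      (hi i).mul_prod (integrable_inner_of_memLp (hW i).1 hξ.1)]
    simp_rw [fun i => integral_prod_mul (μ := P) (ν := halfLine)
      (fun ω => φ (W' ω) * fderiv ℝ f (W ω) (EuclideanSpace.single i 1))
      (fun r => (inner ℝ (h i r) (k r) : ℝ)), EuclideanSpace.apply_eq_sum_single _ a,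
      Finset.mul_sum]
    simp_rw [← mul_assoc]
    rw [integral_finsetSum _ fun i _ => (hi i).mul_const _]
    simp_rw [integral_mul_const]
    rfl
  rw [lhs]
  -- Gaussian integration by parts for the product `f(W) φ(W')`
  have hff : (fun p : EuclideanSpace ℝ (Fin n) × EuclideanSpace ℝ (Fin n') =>
      f p.1 * φ p.2).HasTemperateGrowth :=
    (hf.comp (ContinuousLinearMap.fst ℝ (EuclideanSpace ℝ (Fin n))
      (EuclideanSpace ℝ (Fin n'))).hasTemperateGrowth).mul
      (hφ.comp (ContinuousLinearMap.snd ℝ (EuclideanSpace ℝ (Fin n))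
        (EuclideanSpace ℝ (Fin n'))).hasTemperateGrowth)
  have hcov (L : StrongDual ℝ (EuclideanSpace ℝ (Fin n) × EuclideanSpace ℝ (Fin n'))) :
      cov[fun ω => L (W ω, W' ω), ξ; P] = L (a, a') := by
    have e (x y) : L (x, y) = L.comp (.inl ℝ _ _) x + L.comp (.inr ℝ _ _) y := by
      simp [← map_add]
    simp_rw [e]
    have h1 := IsWienerIntegral.dual hB hW (L.comp (.inl ℝ _ _))
    have h2 := IsWienerIntegral.dual hB hW' (L.comp (.inr ℝ _ _))
    rw [← covariance_dual hB hW hξ, ← covariance_dual hB hW' hξ,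
      ← covariance_add_left h1.2.1 h2.2.1 hξ.2.1]
    rfl
  have ibp := hG.integral_comp_mul_eq_integral_fderiv (hξ.map_eq hB) hcov hff
  have hd (x y) : fderiv ℝ (fun p : EuclideanSpace ℝ (Fin n) × EuclideanSpace ℝ (Fin n') =>
      f p.1 * φ p.2) (x, y) (a, a') = φ y * fderiv ℝ f x a + f x * fderiv ℝ φ y a' := by
    have d1 : HasFDerivAt (fun p : EuclideanSpace ℝ (Fin n) × EuclideanSpace ℝ (Fin n') => f p.1)
        ((fderiv ℝ f x).comp (.fst ℝ _ _)) (x, y) :=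
      (hf.differentiable x).hasFDerivAt.comp (x, y) hasFDerivAt_fst
    have d2 : HasFDerivAt (fun p : EuclideanSpace ℝ (Fin n) × EuclideanSpace ℝ (Fin n') => φ p.2)
        ((fderiv ℝ φ y).comp (.snd ℝ _ _)) (x, y) :=
      (hφ.differentiable y).hasFDerivAt.comp (x, y) hasFDerivAt_snd
    have d3 := (d1.mul d2).fderiv
    simp only [Pi.mul_def] at d3
    rw [d3]
    simp [add_comm]
  simp_rw [hd] at ibp
  have i1 : Integrable (fun ω => φ (W' ω) * fderiv ℝ f (W ω) a) P :=
    (hGW'.memLp_comp hφ (p := 2) (by simp)).integrable_mul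
      (hGW.memLp_comp (hf.fderiv_apply _) (p := 2) (by simp))
  have i2 : Integrable (fun ω => f (W ω) * fderiv ℝ φ (W' ω) a') P :=
    (hGW.memLp_comp hf (p := 2) (by simp)).integrable_mul
      (hGW'.memLp_comp (hφ.fderiv_apply _) (p := 2) (by simp))
  have i3 : Integrable (fun ω => f (W ω) * φ (W' ω) * ξ ω) P :=
    (hG.fst.memLp_comp hff (p := 2) (by simp)).integrable_mul hξ.2.1
  rw [integral_add i1 i2] at ibp
  rw [eq_sub_of_add_eq ibp.symm, ← integral_sub i3 i2]
  congr 1 with ω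
  ring

lemma IsCylindricalPair.memLp (hB : IsBrownianMotion B P) {F : Ω → ℝ}
    {G : Ω → ℝ → EuclideanSpace ℝ (Fin d)} (hFG : IsCylindricalPair B P F G) :
    MemLp F 2 P ∧ MemLp (Function.uncurry G) 2 (P.prod halfLine) := by
  obtain ⟨n, f, h, W, hf, hW, rfl, rfl⟩ := hFG
  have hG := (hasGaussianLaw_prodMk_prodMk hB hW hW (IsWienerIntegral.zero P B)).fst.fst
  refine ⟨hG.memLp_comp hf (by simp), ?_⟩
  exact memLp_finsetSum Finset.univ fun i _ => memLp_two_smul_prod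
    (hG.memLp_comp (hf.fderiv_apply _) (p := 2) (by simp)) (hW i).1

/-- If `(F, G)` and `(F, G')` both lie in the closure of the Malliavin derivative, then `G - G'` is
orthogonal in `L²(Ω; H)` to every `φ k`, where `φ` is a smooth cylindrical functional and `k ∈ H`:
integration by parts moves the derivatives of the approximating functionals onto `φ k`, and
these functionals have the same limit `F`. -/
lemma IsMalliavinDerivative.integral_inner_sub_eq_zero (hB : IsBrownianMotion B P) {F : Ω → ℝ}
    {G G' : Ω → ℝ → EuclideanSpace ℝ (Fin d)} (hG : IsMalliavinDerivative B P F G)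
    (hG' : IsMalliavinDerivative B P F G')
    (hW : ∀ i, IsWienerIntegral B P (h i) (fun ω => W ω i)) (hξ : IsWienerIntegral B P k ξ)
    {φ : EuclideanSpace ℝ (Fin n) → ℝ} (hφ : φ.HasTemperateGrowth) :
    ∫ p, inner ℝ ((Function.uncurry G - Function.uncurry G') p) (φ (W p.1) • k p.2)
      ∂(P.prod halfLine) = 0 := by
  have hGW := (hasGaussianLaw_prodMk_prodMk hB hW hW hξ)
  set Ψ : Ω → ℝ := fun ω => φ (W ω) * ξ ω - fderiv ℝ φ (W ω) (gramVector h k) with hΨ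
  have hφk : MemLp (fun p : Ω × ℝ => φ (W p.1) • k p.2) 2 (P.prod halfLine) :=
    memLp_two_smul_prod (hGW.fst.fst.memLp_comp hφ (by simp)) hξ.1
  have hΨ2 : MemLp Ψ 2 P := by
    let E := EuclideanSpace ℝ (Fin n)
    have h1 : (fun p : (E × E) × ℝ => φ p.1.1 * p.2).HasTemperateGrowth :=
      (hφ.comp ((ContinuousLinearMap.fst ℝ E E).comp
        (ContinuousLinearMap.fst ℝ (E × E) ℝ)).hasTemperateGrowth).mul
        (ContinuousLinearMap.snd ℝ (E × E) ℝ).hasTemperateGrowth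
    exact (hGW.memLp_comp h1 (by simp)).sub
      (hGW.fst.fst.memLp_comp (hφ.fderiv_apply _) (by simp))
  have lim {G : Ω → ℝ → EuclideanSpace ℝ (Fin d)} (hG : IsMalliavinDerivative B P F G) :
      ∫ p, inner ℝ (Function.uncurry G p) (φ (W p.1) • k p.2) ∂(P.prod halfLine) =
        ∫ ω, F ω * Ψ ω ∂P := by
    obtain ⟨hF2, hG2, F', G', hc, t1, t2⟩ := hG
    have l1 := tendsto_integral_inner (fun j => ((hc j).memLp hB).2) hG2 hφk t2
    have l2 := tendsto_integral_inner (fun j => ((hc j).memLp hB).1) hF2 hΨ2 t1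
    simp_rw [fun j => (hc j).integral_inner_eq hB hW hξ hφ] at l1
    simp only [RCLike.inner_apply, conj_trivial, mul_comm] at l2
    refine tendsto_nhds_unique l1 ?_
    convert l2 using 4
  simp_rw [Pi.sub_apply, inner_sub_left]
  rw [integral_sub (integrable_inner_of_memLp hG.2.1 hφk)
    (integrable_inner_of_memLp hG'.2.1 hφk), lim hG, lim hG', sub_self]

/-- The Malliavin derivative is closable: an element of `𝔻^{1,2}` has only one derivative. The
difference of two derivatives is orthogonal to the derivatives of all cylindrical functionals, and
it is itself a limit of such derivatives. -/
theorem IsMalliavinDerivative.ae_eq (hB : IsBrownianMotion B P) {F : Ω → ℝ}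
    {G G' : Ω → ℝ → EuclideanSpace ℝ (Fin d)} (hG : IsMalliavinDerivative B P F G)
    (hG' : IsMalliavinDerivative B P F G') :
    Function.uncurry G =ᵐ[P.prod halfLine] Function.uncurry G' := by
  set η : Ω × ℝ → EuclideanSpace ℝ (Fin d) := Function.uncurry G - Function.uncurry G' with hη
  have hη2 : MemLp η 2 (P.prod halfLine) := hG.2.1.sub hG'.2.1
  have orth {F₁ : Ω → ℝ} {G₁ : Ω → ℝ → EuclideanSpace ℝ (Fin d)}
      (hc : IsCylindricalPair B P F₁ G₁) :
      ∫ p, inner ℝ (Function.uncurry G₁ p) (η p) ∂(P.prod halfLine) = 0 := by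
    obtain ⟨n, f, h, W, hf, hW, rfl, rfl⟩ := hc
    have hGW := (hasGaussianLaw_prodMk_prodMk hB hW hW (IsWienerIntegral.zero P B)).fst.fst
    simp only [Function.uncurry, sum_inner]
    rw [integral_finsetSum _ fun i _ => integrable_inner_of_memLp (memLp_two_smul_prod
      (hGW.memLp_comp (hf.fderiv_apply _) (p := 2) (by simp)) (hW i).1) hη2]
    refine Finset.sum_eq_zero fun i _ => ?_
    simp_rw [real_inner_comm (η _)]
    exact hG.integral_inner_sub_eq_zero hB hG' hW (hW i) (hf.fderiv_apply _)
  have lim {G : Ω → ℝ → EuclideanSpace ℝ (Fin d)} (hG : IsMalliavinDerivative B P F G) :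
      ∫ p, inner ℝ (Function.uncurry G p) (η p) ∂(P.prod halfLine) = 0 := by
    obtain ⟨-, hG2, F', G', hc, -, t2⟩ := hG
    have l1 := tendsto_integral_inner (fun j => ((hc j).memLp hB).2) hG2 hη2 t2
    simp_rw [fun j => orth (hc j)] at l1
    exact tendsto_nhds_unique l1 tendsto_const_nhds
  -- `η = G - G'` is orthogonal to `G` and to `G'`
  have hzero : ∫ p, ‖η p‖ ^ 2 ∂(P.prod halfLine) = 0 := by
    have e (p) : ‖η p‖ ^ 2 = inner ℝ (Function.uncurry G p) (η p) -
        inner ℝ (Function.uncurry G' p) (η p) := by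
      rw [← inner_sub_left, ← real_inner_self_eq_norm_sq]; rfl
    simp_rw [e]
    rw [integral_sub (integrable_inner_of_memLp hG.2.1 hη2)
      (integrable_inner_of_memLp hG'.2.1 hη2), lim hG, lim hG', sub_zero]
  rw [integral_eq_zero_iff_of_nonneg (fun p => by positivity)
    ((memLp_two_iff_integrable_sq_norm hη2.1).1 hη2)] at hzero
  filter_upwards [hzero] with p hp
  have : η p = 0 := by simpa using hp
  exact sub_eq_zero.1 this

/-- The chosen Malliavin derivative agrees with any derivative in the closure. -/
lemma IsMalliavinDerivative.malliavinDeriv_ae_eq (hB : IsBrownianMotion B P) {F : Ω → ℝ}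
    {G : Ω → ℝ → EuclideanSpace ℝ (Fin d)} (hG : IsMalliavinDerivative B P F G) :
    Function.uncurry (malliavinDeriv B P F) =ᵐ[P.prod halfLine] Function.uncurry G := by
  have hF : MemD12 B P F := ⟨G, hG⟩
  have : malliavinDeriv B P F = hF.choose := dif_pos hF
  rw [this]
  exact hF.choose_spec.ae_eq hB hG

/-- Affine functionals of Wiener integrals: `D (c + B(h)) = h`. -/
lemma IsWienerIntegral.isMalliavinDerivative_const_add (hB : IsBrownianMotion B P)
    (hξ : IsWienerIntegral B P k ξ) (c : ℝ) {F : Ω → ℝ} (hF : F =ᵐ[P] fun ω => c + ξ ω) :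
    IsMalliavinDerivative B P F (fun _ r => k r) := by
  have hcyl : IsCylindricalPair B P (fun ω => c + ξ ω) (fun _ r => k r) := by
    let p : EuclideanSpace ℝ (Fin 1) →L[ℝ] ℝ := EuclideanSpace.proj 0
    refine ⟨1, fun x => c + p x, fun _ => k, fun ω => WithLp.toLp 2 fun _ => ξ ω,
      (Function.HasTemperateGrowth.const c).add p.hasTemperateGrowth, fun _ => hξ, rfl, ?_⟩
    ext1 ω
    ext1 r
    have hd : fderiv ℝ (fun x => c + p x) (WithLp.toLp 2 fun _ => ξ ω) = p := by
      rw [fderiv_const_add, p.fderiv]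
    simp only [Finset.univ_unique, Fin.default_eq_zero, Finset.sum_singleton, hd]
    simp [p]
  obtain ⟨m1, m2⟩ := hcyl.memLp hB
  refine ⟨m1.ae_eq hF.symm, m2, fun _ => _, fun _ => _, fun _ => hcyl, ?_, by simp⟩
  have : eLpNorm ((fun ω => c + ξ ω) - F) 2 P = 0 := by
    rw [eLpNorm_congr_ae (g := 0) (by filter_upwards [hF] with ω hω; simp [hω])]
    simp
  simp [this]

end Closability

/-! ### Riemann sums along equidistant partitions -/

section Riemann

/-- The `k`-th point of the equidistant partition of `[0, T]` into `n + 1` intervals. -/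
noncomputable def node (T : ℝ) (n k : ℕ) : ℝ := T * k / (n + 1)

@[simp] lemma node_zero (T : ℝ) (n : ℕ) : node T n 0 = 0 := by simp [node]

@[simp] lemma node_last (T : ℝ) (n : ℕ) : node T n (n + 1) = T := by
  have : (n : ℝ) + 1 ≠ 0 := by positivity
  simp [node]
  field_simp

lemma node_succ_sub (T : ℝ) (n k : ℕ) : node T n (k + 1) - node T n k = T / (n + 1) := by
  simp only [node]
  push_cast
  ring

lemma node_mono {T : ℝ} (hT : 0 ≤ T) (n : ℕ) : Monotone (node T n) := by
  refine monotone_nat_of_le_succ fun k => ?_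
  have h1 := node_succ_sub T n k
  have : 0 ≤ T / ((n : ℝ) + 1) := by positivity
  linarith

lemma node_mem {T : ℝ} (hT : 0 ≤ T) {n k : ℕ} (hk : k ≤ n + 1) : node T n k ∈ Icc 0 T :=
  ⟨by simpa using node_mono hT n (zero_le (a := k)), by simpa using node_mono hT n hk⟩

lemma eventually_mesh_lt (T : ℝ) {δ : ℝ} (hδ : 0 < δ) :
    ∀ᶠ n : ℕ in atTop, T / ((n : ℝ) + 1) < δ := by
  have h1 : Tendsto (fun n : ℕ => T * (1 / ((n : ℝ) + 1))) atTop (𝓝 (T * 0)) :=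
    tendsto_one_div_add_atTop_nhds_zero_nat.const_mul T
  have h2 : Tendsto (fun n : ℕ => T / ((n : ℝ) + 1)) atTop (𝓝 0) := by
    simpa [div_eq_mul_inv] using h1
  exact h2.eventually (gt_mem_nhds hδ)

/-- Riemann sums converge even if the integrator is only absolutely continuous, and if the
continuous factors are evaluated at different end points of the intervals of the partition. -/
lemma tendsto_riemann_sum {T : ℝ} (hT : 0 ≤ T) {F : ℝ → ℝ → ℝ}
    (hF : ContinuousOn (Function.uncurry F) (Icc 0 T ×ˢ Icc 0 T)) {f : ℝ → ℝ}
    (hf : IntervalIntegrable f volume 0 T) :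
    Tendsto (fun n : ℕ => ∑ k ∈ Finset.range (n + 1), F (node T n (k + 1)) (node T n k) *
      ∫ s in node T n k..node T n (k + 1), f s) atTop (𝓝 (∫ s in (0 : ℝ)..T, F s s * f s)) := by
  have hFd : ContinuousOn (fun s => F s s) (Icc 0 T) :=
    hF.comp (f := fun s => (s, s)) (by fun_prop) fun s hs => ⟨hs, hs⟩
  have hFf : IntervalIntegrable (fun s => F s s * f s) volume 0 T :=
    hf.continuousOn_mul (by rwa [uIcc_of_le hT])
  have hsub {n k : ℕ} (hk : k < n + 1) : uIcc (node T n k) (node T n (k + 1)) ⊆ uIcc 0 T := by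
    rw [uIcc_of_le hT]
    exact uIcc_subset_Icc (node_mem hT (by lia)) (node_mem hT (by lia))
  have hadd {g : ℝ → ℝ} (hg : IntervalIntegrable g volume 0 T) (n : ℕ) :
      ∑ k ∈ Finset.range (n + 1), ∫ s in node T n k..node T n (k + 1), g s =
        ∫ s in (0 : ℝ)..T, g s := by
    rw [intervalIntegral.sum_integral_adjacent_intervals (a := node T n)
      fun k hk => hg.mono_set (hsub hk)]
    simp
  rw [Metric.tendsto_atTop]
  intro ε hε
  set I := ∫ s in (0 : ℝ)..T, |f s| with hI
  have hI0 : 0 ≤ I := intervalIntegral.integral_nonneg hT fun _ _ => abs_nonneg _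
  -- For a mesh below `δ`, `F` moves by less than `ε / (I + 1)` on each cell, so the error of the
  -- sum is at most `ε * I / (I + 1)`.
  have huc := (isCompact_Icc.prod isCompact_Icc).uniformContinuousOn_of_continuous hF
  rw [Metric.uniformContinuousOn_iff] at huc
  obtain ⟨δ, hδ, hδF⟩ := huc (ε / (I + 1)) (by positivity)
  obtain ⟨N, hN⟩ := eventually_atTop.1 (eventually_mesh_lt T hδ)
  refine ⟨N, fun n hn => ?_⟩
  have key (k : ℕ) (hk : k ∈ Finset.range (n + 1)) :
      |F (node T n (k + 1)) (node T n k) * (∫ s in node T n k..node T n (k + 1), f s) -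
        ∫ s in node T n k..node T n (k + 1), F s s * f s| ≤
      ∫ s in node T n k..node T n (k + 1), ε / (I + 1) * |f s| := by
    have hk := Finset.mem_range.1 hk
    have hle := node_mono hT n (Nat.le_succ k)
    rw [← intervalIntegral.integral_const_mul, ← intervalIntegral.integral_sub
      ((hf.mono_set (hsub hk)).const_mul _) (hFf.mono_set (hsub hk))]
    refine (Real.norm_eq_abs _).ge.trans ?_
    refine intervalIntegral.norm_integral_le_of_norm_le hle (ae_of_all _ fun s hs => ?_)
      ((hf.mono_set (hsub hk)).abs.const_mul _)
    rw [← sub_mul, Real.norm_eq_abs, abs_mul]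
    refine mul_le_mul_of_nonneg_right ?_ (abs_nonneg _)
    have m1 := node_mem (T := T) hT (n := n) (k := k) (by lia)
    have m2 := node_mem (T := T) hT (n := n) (k := k + 1) (by lia)
    have ms : s ∈ Icc 0 T := ⟨m1.1.trans hs.1.le, hs.2.trans m2.2⟩
    have hmesh := hN n hn
    rw [← node_succ_sub T n k] at hmesh
    refine (hδF (node T n (k + 1), node T n k) ⟨m2, m1⟩ (s, s) ⟨ms, ms⟩ ?_).le
    rw [Prod.dist_eq, max_lt_iff, Real.dist_eq, Real.dist_eq, abs_lt, abs_lt]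
    refine ⟨⟨?_, ?_⟩, ?_, ?_⟩ <;> dsimp only <;> linarith [hs.1, hs.2]
  rw [Real.dist_eq, ← hadd hFf n, ← Finset.sum_sub_distrib]
  refine (Finset.abs_sum_le_sum_abs _ _).trans_lt ((Finset.sum_le_sum key).trans_lt ?_)
  rw [hadd (hf.abs.const_mul _) n, intervalIntegral.integral_const_mul, ← hI,
    div_mul_eq_mul_div, div_lt_iff₀ (by positivity)]
  nlinarith

end Riemann

/-! ### Linear equations with integrable coefficients -/

section LinearODE

/-- Grönwall's inequality with an integrable kernel and no free term. -/
lemma eq_zero_of_le_integral {T : ℝ} (hT : 0 ≤ T) {β u : ℝ → ℝ}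
    (hβ : IntervalIntegrable β volume 0 T) (hβ0 : ∀ s, 0 ≤ β s) (hu : ContinuousOn u (Icc 0 T))
    (hu0 : ∀ t ∈ Icc 0 T, 0 ≤ u t) (hle : ∀ t ∈ Icc 0 T, u t ≤ ∫ s in (0 : ℝ)..t, β s * u s) :
    ∀ t ∈ Icc 0 T, u t = 0 := by
  have hβu : IntervalIntegrable (fun s => β s * u s) volume 0 T :=
    hβ.mul_continuousOn (by rwa [uIcc_of_le hT])
  have sub {g : ℝ → ℝ} (hg : IntervalIntegrable g volume 0 T) {x y : ℝ} (hx : x ∈ Icc 0 T)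
      (hy : y ∈ Icc 0 T) : IntervalIntegrable g volume x y :=
    hg.mono_set (by rw [uIcc_of_le hT]; exact uIcc_subset_Icc hx hy)
  have h0 : (0 : ℝ) ∈ Icc 0 T := ⟨le_rfl, hT⟩
  set U : ℝ → ℝ := fun t => ∫ s in (0 : ℝ)..t, β s * u s with hU
  have hUc : ContinuousOn U (Icc 0 T) := by
    have := intervalIntegral.continuousOn_primitive_interval' hβu left_mem_uIcc
    rwa [uIcc_of_le hT] at this
  have hgc : ContinuousOn (fun t => ∫ s in (0 : ℝ)..t, β s) (Icc 0 T) := by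
    have := intervalIntegral.continuousOn_primitive_interval' hβ left_mem_uIcc
    rwa [uIcc_of_le hT] at this
  have hmono {x y : ℝ} (hx : x ∈ Icc 0 T) (hy : y ∈ Icc 0 T) (hxy : x ≤ y) : U x ≤ U y := by
    have e : U y - U x = ∫ s in x..y, β s * u s :=
      intervalIntegral.integral_interval_sub_left (sub hβu h0 hy) (sub hβu h0 hx)
    have : 0 ≤ ∫ s in x..y, β s * u s := intervalIntegral.integral_nonneg hxy fun s hs =>
      mul_nonneg (hβ0 s) (hu0 s ⟨hx.1.trans hs.1, hs.2.trans hy.2⟩)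
    linarith
  -- The set where `U ≤ 0` is closed and can be extended to the right, by intervals on which the
  -- integral of `β` is at most `1 / 2`.
  have hS : Icc 0 T ⊆ {t | U t ≤ 0} := by
    refine IsClosed.Icc_subset_of_forall_exists_gt ?_ (by simp [hU]) fun x hx y hy => ?_
    · have : {t | U t ≤ 0} ∩ Icc 0 T = Icc 0 T ∩ U ⁻¹' Iic 0 := by
        ext; simp [and_comm]
      rw [this]
      exact hUc.preimage_isClosed_of_isClosed isClosed_Icc isClosed_Iic
    · have hxI : x ∈ Icc 0 T := ⟨hx.2.1, hx.2.2.le⟩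
      have hev : ∀ᶠ z in 𝓝[>] x, ∫ s in (0 : ℝ)..z, β s < (∫ s in (0 : ℝ)..x, β s) + 1 / 2 := by
        have h1 : Tendsto (fun t => ∫ s in (0 : ℝ)..t, β s) (𝓝[>] x)
            (𝓝 (∫ s in (0 : ℝ)..x, β s)) := by
          refine (hgc x hxI).mono_left ?_
          refine (nhdsWithin_le_of_mem ?_)
          exact mem_of_superset (Ioc_mem_nhdsGT hx.2.2)
            fun z hz => ⟨hxI.1.trans hz.1.le, hz.2⟩
        exact h1.eventually (gt_mem_nhds (by linarith))
      obtain ⟨z, hz1, hz2⟩ := (hev.and (Ioc_mem_nhdsGT (lt_min hx.2.2 hy))).exists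
      have hzI : z ∈ Icc 0 T := ⟨hxI.1.trans hz2.1.le, hz2.2.trans (min_le_left _ _)⟩
      refine ⟨z, ?_, hz2.1, hz2.2.trans (min_le_right _ _)⟩
      have e1 : U z - U x = ∫ s in x..z, β s * u s :=
        intervalIntegral.integral_interval_sub_left (sub hβu h0 hzI) (sub hβu h0 hxI)
      have e2 : (∫ s in (0 : ℝ)..z, β s) - ∫ s in (0 : ℝ)..x, β s = ∫ s in x..z, β s :=
        intervalIntegral.integral_interval_sub_left (sub hβ h0 hzI) (sub hβ h0 hxI)
      have e3 : ∫ s in x..z, β s * u s ≤ ∫ s in x..z, β s * U z := by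
        refine intervalIntegral.integral_mono_on hz2.1.le (sub hβu hxI hzI)
          ((sub hβ hxI hzI).mul_const _) fun s hs => ?_
        have hs' : s ∈ Icc 0 T := ⟨hxI.1.trans hs.1, hs.2.trans hzI.2⟩
        exact mul_le_mul_of_nonneg_left ((hle s hs').trans (hmono hs' hzI hs.2)) (hβ0 s)
      rw [intervalIntegral.integral_mul_const] at e3
      have hx0 : U x ≤ 0 := hx.1
      have hUz : 0 ≤ U z := (hu0 z hzI).trans (hle z hzI)
      change U z ≤ 0
      nlinarith
  exact fun t ht => le_antisymm ((hle t ht).trans (hS ht)) (hu0 t ht)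

variable {m : ℕ} {T : ℝ} {b Y : ℝ → Matrix (Fin m) (Fin m) ℝ}

lemma _root_.ContinuousOn.matrix_entry {n l : ℕ} {A : ℝ → Matrix (Fin n) (Fin l) ℝ} {s : Set ℝ}
    (hA : ContinuousOn A s) (i : Fin n) (j : Fin l) : ContinuousOn (fun t => A t i j) s :=
  (continuous_id.matrix_elem i j).comp_continuousOn hA

lemma intervalIntegrable_of_integrableOn_Icc {f : ℝ → ℝ} (hf : IntegrableOn f (Icc 0 T)) {s t : ℝ}
    (hs : s ∈ Icc 0 T) (ht : t ∈ Icc 0 T) : IntervalIntegrable f volume s t :=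
  (hf.mono_set (uIcc_subset_Icc hs ht)).intervalIntegrable

lemma integrableOn_matrix_mul_left (hb : ∀ i j, IntegrableOn (fun t => b t i j) (Icc 0 T)) {l : ℕ}
    {A : ℝ → Matrix (Fin m) (Fin l) ℝ} (hA : ContinuousOn A (Icc 0 T)) (i : Fin m) (j : Fin l) :
    IntegrableOn (fun t => (b t * A t) i j) (Icc 0 T) := by
  simp only [Matrix.mul_apply]
  exact integrable_finsetSum _ fun k _ =>
    (hb i k).mul_continuousOn (hA.matrix_entry k j) isCompact_Icc

lemma integrableOn_matrix_mul_right (hb : ∀ i j, IntegrableOn (fun t => b t i j) (Icc 0 T)) {l : ℕ}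
    {A : ℝ → Matrix (Fin l) (Fin m) ℝ} (hA : ContinuousOn A (Icc 0 T)) (i : Fin l) (j : Fin m) :
    IntegrableOn (fun t => (A t * b t) i j) (Icc 0 T) := by
  simp only [Matrix.mul_apply]
  exact integrable_finsetSum _ fun k _ =>
    (hb k j).continuousOn_mul (hA.matrix_entry i k) isCompact_Icc

lemma IsFirstVariation.sub_eq_integral (hY : IsFirstVariation T b Y)
    (hb : ∀ i j, IntegrableOn (fun t => b t i j) (Icc 0 T)) {s t : ℝ} (hs : s ∈ Icc 0 T)
    (ht : t ∈ Icc 0 T) (i j : Fin m) :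
    Y t i j - Y s i j = ∫ r in s..t, (b r * Y r) i j := by
  have h0 : (0 : ℝ) ∈ Icc 0 T := ⟨le_rfl, hs.1.trans hs.2⟩
  have hi := integrableOn_matrix_mul_left hb hY.continuousOn i j
  rw [hY.eq t ht, hY.eq s hs, add_sub_add_left_eq_sub]
  exact intervalIntegral.integral_interval_sub_left
    (intervalIntegrable_of_integrableOn_Icc hi h0 ht)
    (intervalIntegrable_of_integrableOn_Icc hi h0 hs)

/-- A solution of a linear equation that vanishes at time `r` vanishes before `r`, by Grönwall's
inequality run backwards in time; hence `Y r` has trivial kernel. -/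
lemma IsFirstVariation.isUnit (hY : IsFirstVariation T b Y)
    (hb : ∀ i j, IntegrableOn (fun t => b t i j) (Icc 0 T)) {r : ℝ} (hr : r ∈ Icc 0 T) :
    IsUnit (Y r) := by
  rw [← Matrix.mulVec_injective_iff_isUnit]
  refine (injective_iff_map_eq_zero (Matrix.mulVecLin (Y r))).2 fun v hv => ?_
  have hv : (Y r).mulVec v = 0 := hv
  have h0T : (0 : ℝ) ∈ Icc 0 T := ⟨le_rfl, hr.1.trans hr.2⟩
  have hmem {t : ℝ} (ht : t ∈ Icc 0 r) : r - t ∈ Icc 0 T :=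
    ⟨by linarith [ht.2], by linarith [ht.1, hr.2]⟩
  -- time reversed at `r`, with the `ℓ¹` norm of `Y v`
  set β : ℝ → ℝ := fun s => ∑ i, ∑ j, |b (r - s) i j| with hβ
  set u : ℝ → ℝ := fun s => ∑ i, |(Y (r - s)).mulVec v i| with hu
  have hYv (i) : ContinuousOn (fun t => (Y t).mulVec v i) (Icc 0 T) := by
    simp only [Matrix.mulVec, dotProduct]
    exact continuousOn_finsetSum _ fun j _ =>
      (hY.continuousOn.matrix_entry i j).mul continuousOn_const
  have huc : ContinuousOn u (Icc 0 r) := continuousOn_finsetSum _ fun i _ =>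
    ((hYv i).comp (f := fun s => r - s) (by fun_prop) fun s hs => hmem hs).abs
  have hba (i j) : IntegrableOn (fun t => |b t i j|) (Icc 0 T) := (hb i j).abs
  have hβi : IntervalIntegrable β volume 0 r := by
    have h1 : IntervalIntegrable (fun s => ∑ i, ∑ j, |b s i j|) volume r 0 := by
      refine intervalIntegrable_of_integrableOn_Icc ?_ hr h0T
      exact integrable_finsetSum _ fun i _ => integrable_finsetSum _ fun j _ => hba i j
    simpa using h1.comp_sub_left r
  have hbound : ∀ t ∈ Icc 0 r, u t ≤ ∫ s in (0 : ℝ)..t, β s * u s := by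
    intro t ht
    have hint (i : Fin m) : IntegrableOn (fun s => ∑ j, b s i j * (Y s).mulVec v j) (Icc 0 T) :=
      integrable_finsetSum _ fun j _ => (hb i j).mul_continuousOn (hYv j) isCompact_Icc
    have e1 (i : Fin m) : (Y (r - t)).mulVec v i =
        -∫ s in (r - t)..r, ∑ j, b s i j * (Y s).mulVec v j := by
      have h1 : (Y r).mulVec v i - (Y (r - t)).mulVec v i =
          ∫ s in (r - t)..r, ∑ j, b s i j * (Y s).mulVec v j := by
        simp only [Matrix.mulVec, dotProduct]
        rw [← Finset.sum_sub_distrib]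
        simp_rw [← sub_mul, hY.sub_eq_integral hb (hmem ht) hr,
          ← intervalIntegral.integral_mul_const]
        rw [← intervalIntegral.integral_finsetSum fun j _ =>
          (intervalIntegrable_of_integrableOn_Icc
            (integrableOn_matrix_mul_left hb hY.continuousOn i j) (hmem ht) hr).mul_const _]
        refine intervalIntegral.integral_congr fun s _ => ?_
        simp only [Matrix.mul_apply, Finset.sum_mul, Finset.mul_sum]
        rw [Finset.sum_comm]
        exact Finset.sum_congr rfl fun k _ => Finset.sum_congr rfl fun j _ => by ring
      rw [hv, Pi.zero_apply, zero_sub] at h1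
      rw [← h1, neg_neg]
    have e2 (i : Fin m) : |(Y (r - t)).mulVec v i| ≤
        ∫ s in (r - t)..r, ∑ j, |b s i j| * |(Y s).mulVec v j| := by
      rw [e1, abs_neg]
      refine (Real.norm_eq_abs _).ge.trans ?_
      refine intervalIntegral.norm_integral_le_of_norm_le (by linarith [ht.1])
        (ae_of_all _ fun s _ => ?_) ?_
      · refine (Finset.abs_sum_le_sum_abs _ _).trans_eq ?_
        simp_rw [abs_mul]
      · refine intervalIntegrable_of_integrableOn_Icc ?_ (hmem ht) hr
        exact integrable_finsetSum _ fun j _ =>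
          (hba i j).mul_continuousOn (hYv j).abs isCompact_Icc
    have e3 : ∫ s in (0 : ℝ)..t, β s * u s = ∫ s in (r - t)..r,
        (∑ i, ∑ j, |b s i j|) * ∑ i, |(Y s).mulVec v i| := by
      have := intervalIntegral.integral_comp_sub_left (a := 0) (b := t)
        (fun s => (∑ i, ∑ j, |b s i j|) * ∑ i, |(Y s).mulVec v i|) r
      rw [sub_zero] at this
      exact this
    have hsum : IntegrableOn (fun s => ∑ i, ∑ j, |b s i j| * |(Y s).mulVec v j|) (Icc 0 T) :=
      integrable_finsetSum _ fun i _ => integrable_finsetSum _ fun j _ =>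
        (hba i j).mul_continuousOn (hYv j).abs isCompact_Icc
    have hprod : IntegrableOn (fun s => (∑ i, ∑ j, |b s i j|) * ∑ i, |(Y s).mulVec v i|)
        (Icc 0 T) :=
      IntegrableOn.mul_continuousOn (integrable_finsetSum _ fun i _ =>
        integrable_finsetSum _ fun j _ => hba i j)
        (continuousOn_finsetSum _ fun i _ => (hYv i).abs) isCompact_Icc
    rw [e3]
    refine (Finset.sum_le_sum fun i _ => e2 i).trans ?_
    rw [← intervalIntegral.integral_finsetSum fun i _ => intervalIntegrable_of_integrableOn_Icc
      (integrable_finsetSum _ fun j _ =>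
        (hba i j).mul_continuousOn (hYv j).abs isCompact_Icc) (hmem ht) hr]
    refine intervalIntegral.integral_mono_on (by linarith [ht.1])
      (intervalIntegrable_of_integrableOn_Icc hsum (hmem ht) hr)
      (intervalIntegrable_of_integrableOn_Icc hprod (hmem ht) hr) fun s _ => ?_
    simp_rw [Finset.sum_mul]
    refine Finset.sum_le_sum fun i _ => Finset.sum_le_sum fun j _ => ?_
    exact mul_le_mul_of_nonneg_left
      (Finset.single_le_sum (f := fun i => |(Y s).mulVec v i|) (fun _ _ => abs_nonneg _)
        (Finset.mem_univ j)) (abs_nonneg _)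
  have hzero := eq_zero_of_le_integral hr.1 hβi
    (fun s => Finset.sum_nonneg fun i _ => Finset.sum_nonneg fun j _ => abs_nonneg _) huc
    (fun s _ => Finset.sum_nonneg fun i _ => abs_nonneg _) hbound r ⟨hr.1, le_rfl⟩
  have hY0 : Y 0 = 1 := by
    ext i j
    rw [hY.eq 0 h0T]
    simp
  ext i
  have := (Finset.sum_eq_zero_iff_of_nonneg fun i _ => abs_nonneg _).1 hzero i (Finset.mem_univ i)
  simpa [hY0] using this

lemma IsFirstVariation.continuousOn_inv (hY : IsFirstVariation T b Y)
    (hb : ∀ i j, IntegrableOn (fun t => b t i j) (Icc 0 T)) :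
    ContinuousOn (fun t => (Y t)⁻¹) (Icc 0 T) := by
  simp_rw [Matrix.inv_def, Ring.inverse_eq_inv']
  have hdet : Continuous fun M : Matrix (Fin m) (Fin m) ℝ => M.det := continuous_id.matrix_det
  have hadj : Continuous fun M : Matrix (Fin m) (Fin m) ℝ => M.adjugate :=
    continuous_id.matrix_adjugate
  have h1 : ContinuousOn (fun t => (Y t).det⁻¹) (Icc 0 T) :=
    (hdet.comp_continuousOn hY.continuousOn).inv₀ fun t ht =>
      ((Matrix.isUnit_iff_isUnit_det _).1 (hY.isUnit hb ht)).ne_zero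
  have h2 : ContinuousOn (fun t => (Y t).adjugate) (Icc 0 T) :=
    hadj.comp_continuousOn hY.continuousOn
  exact h1.smul h2

/-- The inverse of the first variation process solves `d(Y⁻¹) = -Y⁻¹ b dt`. The increments of
`Y⁻¹` along a partition are `-Y_{k+1}⁻¹ (Y_{k+1} - Y_k) Y_k⁻¹`, and their sum is a Riemann sum. -/
lemma IsFirstVariation.inv_eq (hY : IsFirstVariation T b Y)
    (hb : ∀ i j, IntegrableOn (fun t => b t i j) (Icc 0 T)) {t : ℝ} (ht : t ∈ Icc 0 T)
    (i j : Fin m) :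
    (Y t)⁻¹ i j - (Y 0)⁻¹ i j = -∫ s in (0 : ℝ)..t, ((Y s)⁻¹ * b s) i j := by
  have hN := hY.continuousOn_inv hb
  have h0 : (0 : ℝ) ∈ Icc 0 T := ⟨le_rfl, ht.1.trans ht.2⟩
  have hsub : Icc 0 t ⊆ Icc 0 T := Icc_subset_Icc_right ht.2
  have hnode {n k : ℕ} (hk : k ≤ n + 1) : node t n k ∈ Icc 0 T := hsub (node_mem ht.1 hk)
  have hdet {s : ℝ} (hs : s ∈ Icc 0 T) : IsUnit (Y s).det :=
    (Matrix.isUnit_iff_isUnit_det _).1 (hY.isUnit hb hs)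
  have hbY (p q) := intervalIntegrable_of_integrableOn_Icc
    (integrableOn_matrix_mul_left hb hY.continuousOn p q) h0 ht
  have incr {s s' : ℝ} (hs : s ∈ Icc 0 T) (hs' : s' ∈ Icc 0 T) :
      (Y s')⁻¹ i j - (Y s)⁻¹ i j = -∑ p, ∑ q, (Y s')⁻¹ i p * (Y s)⁻¹ q j *
        ∫ r in s..s', (b r * Y r) p q := by
    have e : (Y s')⁻¹ - (Y s)⁻¹ = -((Y s')⁻¹ * (Y s' - Y s) * (Y s)⁻¹) := by
      rw [mul_sub, Matrix.nonsing_inv_mul _ (hdet hs'), sub_mul, one_mul, mul_assoc,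
        Matrix.mul_nonsing_inv _ (hdet hs), mul_one, neg_sub]
    rw [← Matrix.sub_apply, e, Matrix.neg_apply, Matrix.mul_apply]
    simp_rw [Matrix.mul_apply, Matrix.sub_apply, hY.sub_eq_integral hb hs hs', Finset.sum_mul]
    rw [Finset.sum_comm]
    congr 1
    refine Finset.sum_congr rfl fun p _ => Finset.sum_congr rfl fun q _ => ?_
    simp only [Matrix.mul_apply]
    ring
  have lim (p q : Fin m) := tendsto_riemann_sum ht.1
    (F := fun x y => (Y x)⁻¹ i p * (Y y)⁻¹ q j)
    (((hN.matrix_entry i p).mono hsub |>.comp continuousOn_fst fun x hx => hx.1).mul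
      ((hN.matrix_entry q j).mono hsub |>.comp continuousOn_snd fun x hx => hx.2)) (hbY p q)
  have lim2 := (tendsto_finsetSum Finset.univ fun p _ =>
    tendsto_finsetSum Finset.univ fun q _ => lim p q).neg
  have const (n : ℕ) : -∑ p, ∑ q, ∑ k ∈ Finset.range (n + 1),
      (Y (node t n (k + 1)))⁻¹ i p * (Y (node t n k))⁻¹ q j *
        ∫ r in node t n k..node t n (k + 1), (b r * Y r) p q = (Y t)⁻¹ i j - (Y 0)⁻¹ i j := by
    have tel := Finset.sum_range_sub (fun k => (Y (node t n k))⁻¹ i j) (n + 1)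
    rw [node_last, node_zero] at tel
    rw [← tel]
    simp_rw [Finset.sum_comm (s := (Finset.univ : Finset (Fin m))) (t := Finset.range (n + 1))]
    rw [← Finset.sum_neg_distrib]
    refine Finset.sum_congr rfl fun k hk => ?_
    have hk := Finset.mem_range.1 hk
    rw [incr (hnode (by lia)) (hnode (by lia))]
  simp_rw [const] at lim2
  rw [tendsto_nhds_unique tendsto_const_nhds lim2]
  congr 1
  have hNc (p q) : ContinuousOn (fun s => (Y s)⁻¹ i p * (Y s)⁻¹ q j) (uIcc 0 t) := by
    rw [uIcc_of_le ht.1]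
    exact (((hN.matrix_entry i p).mul (hN.matrix_entry q j)).mono hsub)
  have hsum (p) : IntervalIntegrable
      (fun s => ∑ q, (Y s)⁻¹ i p * (Y s)⁻¹ q j * (b s * Y s) p q) volume 0 t := by
    have := IntervalIntegrable.sum Finset.univ fun q _ => (hbY p q).continuousOn_mul (hNc p q)
    rwa [Finset.sum_fn] at this
  simp_rw [← intervalIntegral.integral_finsetSum fun q _ => (hbY _ q).continuousOn_mul (hNc _ q)]
  rw [← intervalIntegral.integral_finsetSum fun p _ => hsum p]
  refine intervalIntegral.integral_congr fun s hs => ?_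
  rw [uIcc_of_le ht.1] at hs
  have e : (Y s)⁻¹ * b s = (Y s)⁻¹ * (b s * Y s) * (Y s)⁻¹ := by
    rw [mul_assoc, mul_assoc, Matrix.mul_nonsing_inv _ (hdet (hsub hs)), mul_one]
  have e' (q) : ((Y s)⁻¹ * (b s * Y s)) i q = ∑ p, (Y s)⁻¹ i p * (b s * Y s) p q :=
    Matrix.mul_apply
  rw [e, Matrix.mul_apply]
  simp_rw [e', Finset.sum_mul]
  rw [Finset.sum_comm]
  exact Finset.sum_congr rfl fun p _ => Finset.sum_congr rfl fun q _ => by ring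

end LinearODE

/-! ### The solution of the linear equation as a Wiener integral -/

section Representation

variable {m : ℕ} {T : ℝ}

/-- Variation of constants along a single path: if `x` solves `x = x₀ + ∫ b x + z` and `q` solves
the adjoint equation `dq = -q b dt`, then the Riemann–Stieltjes sums of `q` against `z` converge to
`q(T) · x(T) - q(0) · x(0)`. Summation by parts turns them into Riemann sums against the absolutely
continuous functions `q` and `∫ b x`, whose limits cancel. -/
lemma tendsto_sum_mul_increment (hT : 0 ≤ T) {b : ℝ → Matrix (Fin m) (Fin m) ℝ}
    (hb : ∀ i j, IntegrableOn (fun t => b t i j) (Icc 0 T)) {q x : ℝ → Fin m → ℝ}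
    (hq : ∀ j, ContinuousOn (fun t => q t j) (Icc 0 T))
    (hx : ∀ j, ContinuousOn (fun t => x t j) (Icc 0 T))
    (hqb : ∀ t ∈ Icc 0 T, ∀ j, q t j - q 0 j = -∫ s in (0 : ℝ)..t, ∑ i, q s i * b s i j)
    {x₀ : Fin m → ℝ} {z : ℝ → Fin m → ℝ}
    (hz : ∀ n k, k ≤ n + 1 → ∀ j, x (node T n k) j = x₀ j +
      (∫ s in (0 : ℝ)..node T n k, (b s).mulVec (x s) j) + z (node T n k) j) :
    Tendsto (fun n : ℕ => ∑ k ∈ Finset.range (n + 1), ∑ j, q (node T n k) j *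
      (z (node T n (k + 1)) j - z (node T n k) j)) atTop
      (𝓝 (∑ j, q T j * x T j - ∑ j, q 0 j * x 0 j)) := by
  have h0 : (0 : ℝ) ∈ Icc 0 T := ⟨le_rfl, hT⟩
  have hTT : T ∈ Icc 0 T := ⟨hT, le_rfl⟩
  have iq (j) : IntegrableOn (fun s => ∑ i, q s i * b s i j) (Icc 0 T) :=
    integrable_finsetSum _ fun i _ => (hb i j).continuousOn_mul (hq i) isCompact_Icc
  have ix (j) : IntegrableOn (fun s => (b s).mulVec (x s) j) (Icc 0 T) := by
    simp only [Matrix.mulVec, dotProduct]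
    exact integrable_finsetSum _ fun i _ => (hb j i).mul_continuousOn (hx i) isCompact_Icc
  have lim1 := tendsto_finsetSum Finset.univ fun j _ => tendsto_riemann_sum hT
    (F := fun s _ => x s j) ((hx j).comp continuousOn_fst fun p hp => hp.1)
    (intervalIntegrable_of_integrableOn_Icc (iq j) h0 hTT)
  have lim2 := tendsto_finsetSum Finset.univ fun j _ => tendsto_riemann_sum hT
    (F := fun _ s => q s j) ((hq j).comp continuousOn_snd fun p hp => hp.2)
    (intervalIntegrable_of_integrableOn_Icc (ix j) h0 hTT)
  have cancel : ∑ j, ∫ s in (0 : ℝ)..T, x s j * ∑ i, q s i * b s i j =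
      ∑ j, ∫ s in (0 : ℝ)..T, q s j * (b s).mulVec (x s) j := by
    rw [← intervalIntegral.integral_finsetSum fun j _ => intervalIntegrable_of_integrableOn_Icc
        (IntegrableOn.continuousOn_mul (hx j) (iq j) isCompact_Icc) h0 hTT,
      ← intervalIntegral.integral_finsetSum fun j _ => intervalIntegrable_of_integrableOn_Icc
        (IntegrableOn.continuousOn_mul (hq j) (ix j) isCompact_Icc) h0 hTT]
    refine intervalIntegral.integral_congr fun s _ => ?_
    simp only [Matrix.mulVec, dotProduct, Finset.mul_sum]
    rw [Finset.sum_comm]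
    exact Finset.sum_congr rfl fun i _ => Finset.sum_congr rfl fun j _ => by ring
  have lim := (lim1.sub lim2).const_add (∑ j, q T j * x T j - ∑ j, q 0 j * x 0 j)
  rw [cancel, sub_self, add_zero] at lim
  refine lim.congr fun n => ?_
  have tel := Finset.sum_range_sub (fun k => ∑ j, q (node T n k) j * x (node T n k) j) (n + 1)
  rw [node_last, node_zero] at tel
  rw [← tel, Finset.sum_comm (s := Finset.univ), Finset.sum_comm (s := Finset.univ),
    ← Finset.sum_sub_distrib, ← Finset.sum_add_distrib]
  refine Finset.sum_congr rfl fun k hk => ?_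
  have hk := Finset.mem_range.1 hk
  have m1 := node_mem hT (n := n) (k := k) (by lia)
  have m2 := node_mem hT (n := n) (k := k + 1) (by lia)
  rw [← Finset.sum_sub_distrib, ← Finset.sum_sub_distrib, ← Finset.sum_add_distrib]
  refine Finset.sum_congr rfl fun j _ => ?_
  have e1 : q (node T n (k + 1)) j - q (node T n k) j =
      -∫ s in node T n k..node T n (k + 1), ∑ i, q s i * b s i j := by
    rw [← intervalIntegral.integral_interval_sub_left
      (intervalIntegrable_of_integrableOn_Icc (iq j) h0 m2)
      (intervalIntegrable_of_integrableOn_Icc (iq j) h0 m1)]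
    linarith [hqb _ m1 j, hqb _ m2 j]
  have e2 : z (node T n (k + 1)) j - z (node T n k) j = x (node T n (k + 1)) j -
      x (node T n k) j - ∫ s in node T n k..node T n (k + 1), (b s).mulVec (x s) j := by
    rw [← intervalIntegral.integral_interval_sub_left
      (intervalIntegrable_of_integrableOn_Icc (ix j) h0 m2)
      (intervalIntegrable_of_integrableOn_Icc (ix j) h0 m1)]
    linarith [hz n k (by lia) j, hz n (k + 1) (by lia) j]
  rw [e2, ← neg_eq_iff_eq_neg.2 e1]
  ring

/-- Replacing a continuous factor `q` by its left end point values on a partition changes `q τ` at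
most by the oscillation of `q` times `‖τ‖`. -/
lemma norm_sum_indicator_sub_le {E : Type*} [NormedAddCommGroup E] [NormedSpace ℝ E] (hT : 0 ≤ T)
    {q : ℝ → ℝ} (τ : ℝ → E) {n : ℕ} {ε : ℝ}
    (hq : ∀ r ∈ Icc 0 T, ∀ s ∈ Icc 0 T, |s - r| ≤ T / (n + 1) → |q s - q r| ≤ ε) (r : ℝ) :
    ‖∑ k ∈ Finset.range (n + 1), q (node T n k) • ((Ioc 0 (node T n (k + 1))).indicator τ r -
      (Ioc 0 (node T n k)).indicator τ r) - (Ioc 0 T).indicator (fun r => q r • τ r) r‖ ≤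
    ε * ‖(Ioc 0 T).indicator τ r‖ := by
  by_cases hr : r ∈ Ioc 0 T
  · set w : ℕ → ℝ := fun k => (Ioc 0 (node T n k)).indicator 1 r with hw
    have e (k) : (Ioc 0 (node T n k)).indicator τ r = w k • τ r := by
      by_cases h : r ∈ Ioc 0 (node T n k) <;> simp [hw, h]
    have hsum : ∑ k ∈ Finset.range (n + 1), (w (k + 1) - w k) = 1 := by
      rw [Finset.sum_range_sub]
      simp [hw, hr]
    have hwk (k) : 0 ≤ w (k + 1) - w k := by
      rw [sub_nonneg]
      exact indicator_le_indicator_of_subset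
        (Ioc_subset_Ioc_right (node_mono hT n (Nat.le_succ k))) (fun _ => zero_le_one) r
    rw [indicator_of_mem hr, indicator_of_mem hr]
    simp_rw [e, ← sub_smul, smul_smul]
    rw [← Finset.sum_smul, ← sub_smul, norm_smul]
    refine mul_le_mul_of_nonneg_right ?_ (norm_nonneg _)
    have e2 : ∑ k ∈ Finset.range (n + 1), q (node T n k) * (w (k + 1) - w k) - q r =
        ∑ k ∈ Finset.range (n + 1), (q (node T n k) - q r) * (w (k + 1) - w k) := by
      simp_rw [sub_mul]
      rw [Finset.sum_sub_distrib, ← Finset.mul_sum, hsum, mul_one]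
    have e3 : ε = ∑ k ∈ Finset.range (n + 1), ε * (w (k + 1) - w k) := by
      rw [← Finset.mul_sum, hsum, mul_one]
    rw [e2, e3]
    refine (norm_sum_le _ _).trans (Finset.sum_le_sum fun k hk => ?_)
    have hk := Finset.mem_range.1 hk
    rw [norm_mul, Real.norm_eq_abs, Real.norm_eq_abs, abs_of_nonneg (hwk k)]
    by_cases hrk : node T n k < r ∧ r ≤ node T n (k + 1)
    · refine mul_le_mul_of_nonneg_right
        (hq r ⟨hr.1.le, hr.2⟩ _ (node_mem hT (by lia)) ?_) (hwk k)
      rw [← node_succ_sub T n k, abs_le]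
      constructor <;> linarith [hrk.1, hrk.2]
    · have : w (k + 1) - w k = 0 := by
        have hle := node_mono hT n (Nat.le_succ k)
        simp only [hw, indicator_apply, mem_Ioc, hr.1, true_and, Pi.one_apply]
        split_ifs with h1 h2 h2
        · simp
        · exact absurd ⟨not_le.1 h2, h1⟩ hrk
        · exact absurd (h2.trans hle) h1
        · simp
      simp [this]
  · have e (k) (hk : k ≤ n + 1) : (Ioc 0 (node T n k)).indicator τ r = 0 :=
      indicator_of_notMem (fun h => hr ⟨h.1, h.2.trans (node_mem hT hk).2⟩) _
    rw [indicator_of_notMem hr, indicator_of_notMem hr, Finset.sum_eq_zero]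
    · simp
    · intro k hk
      have hk := Finset.mem_range.1 hk
      rw [e k (by lia), e (k + 1) (by lia), sub_zero, smul_zero]

lemma memLp_continuousOn_smul {E : Type*} [NormedAddCommGroup E] [NormedSpace ℝ E] {q : ℝ → ℝ}
    (hq : ContinuousOn q (Icc 0 T)) {τ : ℝ → E} {p : ℝ≥0∞}
    (hτ : MemLp τ p (volume.restrict (Ioc 0 T))) :
    MemLp (fun r => q r • τ r) p (volume.restrict (Ioc 0 T)) := by
  obtain ⟨C, hC⟩ := isCompact_Icc.exists_bound_of_continuousOn hq
  refine hτ.of_le_mul (c := C) (((hq.mono Ioc_subset_Icc_self).aestronglyMeasurable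
    measurableSet_Ioc).smul hτ.1) ?_
  filter_upwards [ae_restrict_mem measurableSet_Ioc] with r hr
  rw [norm_smul]
  exact mul_le_mul_of_nonneg_right (hC r (Ioc_subset_Icc_self hr)) (norm_nonneg _)

lemma halfLine_restrict_Ioc (T : ℝ) :
    halfLine.restrict (Ioc 0 T) = volume.restrict (Ioc 0 T) := by
  rw [Measure.restrict_restrict measurableSet_Ioc, inter_eq_left.2 fun x hx => hx.1]

variable {Ω : Type*} [MeasurableSpace Ω] {P : Measure Ω} [IsProbabilityMeasure P] {d : ℕ}
variable {B : ℝ≥0 → Ω → EuclideanSpace ℝ (Fin d)}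
variable {b : ℝ → Matrix (Fin m) (Fin m) ℝ} {σ : ℝ → Matrix (Fin m) (Fin d) ℝ} {x₀ : Fin m → ℝ}
variable {X : ℝ → Ω → Fin m → ℝ} {Y : ℝ → Matrix (Fin m) (Fin m) ℝ}

/-- The integrand `1_{(0, T]}(r) (Y_T Y_r⁻¹ σ(r))ᵢ`, which is the Malliavin derivative of the `i`-th
component of `X_T`. -/
noncomputable def flowIntegrand (T : ℝ) (Y : ℝ → Matrix (Fin m) (Fin m) ℝ)
    (σ : ℝ → Matrix (Fin m) (Fin d) ℝ) (i : Fin m) : ℝ → EuclideanSpace ℝ (Fin d) :=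
  (Ioc 0 T).indicator fun r => WithLp.toLp 2 ((Y T * (Y r)⁻¹ * σ r) i)

/-- Up to a constant, each component of `X_T` is the Wiener integral of `flowIntegrand`. It is an
almost sure limit of sums `∑ k, Y_T Y_{s_k}⁻¹ (Z_{s_{k+1}} - Z_{s_k})` with `Z = ∫ σ dB`, which are
Wiener integrals of integrands that converge in `H`. -/
lemma IsLinearSDESolution.exists_isWienerIntegral (hB : IsBrownianMotion B P) (hT : 0 < T)
    (hb : ∀ i j, IntegrableOn (fun t => b t i j) (Icc 0 T))
    (hX : IsLinearSDESolution B P T b σ x₀ X) (hY : IsFirstVariation T b Y) (i : Fin m) :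
    ∃ (c : ℝ) (ξ : Ω → ℝ), IsWienerIntegral B P (flowIntegrand T Y σ i) ξ ∧
      (fun ω => X T ω i) =ᵐ[P] fun ω => c + ξ ω := by
  have h0 : (0 : ℝ) ∈ Icc 0 T := ⟨le_rfl, hT.le⟩
  have hTT : T ∈ Icc 0 T := ⟨hT.le, le_rfl⟩
  have hZ' : ∀ t j, ∃ Z : Ω → ℝ, t ∈ Icc 0 T →
      IsWienerIntegral B P ((Ioc 0 t).indicator fun r => WithLp.toLp 2 (σ r j)) Z ∧
      ∀ᵐ ω ∂P, X t ω j = x₀ j + (∫ s in (0 : ℝ)..t, (b s).mulVec (X s ω) j) + Z ω := by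
    intro t j
    by_cases ht : t ∈ Icc 0 T
    · obtain ⟨Z, hZ⟩ := hX.eq t ht j
      exact ⟨Z, fun _ => hZ⟩
    · exact ⟨0, fun h => absurd h ht⟩
  choose Z hZ using hZ'
  set τ : Fin m → ℝ → EuclideanSpace ℝ (Fin d) := fun j r => WithLp.toLp 2 (σ r j) with hτ
  -- the `i`-th row of `Y_T Y_r⁻¹`
  set q : ℝ → Fin m → ℝ := fun r j => (Y T * (Y r)⁻¹) i j with hq
  have hN := hY.continuousOn_inv hb
  have hqc (j) : ContinuousOn (fun t => q t j) (Icc 0 T) := by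
    simp only [hq, Matrix.mul_apply]
    exact continuousOn_finsetSum _ fun k _ => continuousOn_const.mul (hN.matrix_entry k j)
  have hqb : ∀ t ∈ Icc 0 T, ∀ j, q t j - q 0 j =
      -∫ s in (0 : ℝ)..t, ∑ l, q s l * b s l j := by
    intro t ht j
    have hint (k) := intervalIntegrable_of_integrableOn_Icc
      (integrableOn_matrix_mul_right hb hN k j) h0 ht
    simp only [hq, Matrix.mul_apply (M := Y T)]
    rw [← Finset.sum_sub_distrib]
    simp_rw [← mul_sub, hY.inv_eq hb ht, mul_neg, ← intervalIntegral.integral_const_mul]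
    rw [Finset.sum_neg_distrib,
      ← intervalIntegral.integral_finsetSum fun k _ => (hint k).const_mul _]
    congr 1
    refine intervalIntegral.integral_congr fun s _ => ?_
    simp only [Matrix.mul_apply, Finset.mul_sum, Finset.sum_mul]
    rw [Finset.sum_comm]
    exact Finset.sum_congr rfl fun l _ => Finset.sum_congr rfl fun k _ => by ring
  have hqT (j) : q T j = (1 : Matrix (Fin m) (Fin m) ℝ) i j := by
    simp only [hq]
    rw [Matrix.mul_nonsing_inv _ ((Matrix.isUnit_iff_isUnit_det _).1 (hY.isUnit hb hTT))]
  -- at time `0` the Wiener integral has the zero integrand, so it vanishes by the isometry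
  have hX0 : ∀ᵐ ω ∂P, ∀ j, X 0 ω j = x₀ j := by
    refine ae_all_iff.2 fun j => ?_
    obtain ⟨hw, he⟩ := hZ 0 j h0
    have hn := hw.eLpNorm_eq hB
    rw [Ioc_self, indicator_empty, show (fun _ : ℝ => (0 : EuclideanSpace ℝ (Fin d))) = 0 from rfl,
      eLpNorm_zero, eLpNorm_eq_zero_iff hw.2.1.1 two_ne_zero] at hn
    filter_upwards [he, hn] with ω h1 h2
    rw [h1, h2]
    simp
  -- the null set of the equation depends on the time, but only countably many nodes occur
  have hXZ : ∀ᵐ ω ∂P, ∀ n k, k ≤ n + 1 → ∀ j, X (node T n k) ω j = x₀ j +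
      (∫ s in (0 : ℝ)..node T n k, (b s).mulVec (X s ω) j) + Z (node T n k) j ω := by
    refine ae_all_iff.2 fun n => ae_all_iff.2 fun k => ?_
    by_cases hk : k ≤ n + 1
    · filter_upwards [ae_all_iff.2 fun j => (hZ (node T n k) j (node_mem hT.le hk)).2] with ω hω _
      exact hω
    · exact ae_of_all _ fun ω h => absurd h hk
  set c : ℝ := ∑ j, q 0 j * x₀ j with hc
  -- the approximating integrands and their Wiener integrals
  let g (n : ℕ) : ℝ → EuclideanSpace ℝ (Fin d) := ∑ k ∈ Finset.range (n + 1), ∑ j,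
    q (node T n k) j • ((Ioc 0 (node T n (k + 1))).indicator (τ j) -
      (Ioc 0 (node T n k)).indicator (τ j))
  let V (n : ℕ) : Ω → ℝ := ∑ k ∈ Finset.range (n + 1), ∑ j,
    q (node T n k) j • (Z (node T n (k + 1)) j - Z (node T n k) j)
  have hV (n) : IsWienerIntegral B P (g n) (V n) := by
    refine IsWienerIntegral.sum hB _ fun k hk => IsWienerIntegral.sum hB _ fun j _ => ?_
    have hk := Finset.mem_range.1 hk
    exact ((hZ _ j (node_mem hT.le (by lia))).1.sub hB
      (hZ _ j (node_mem hT.le (by lia))).1).smul _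
  have hlim : ∀ᵐ ω ∂P, Tendsto (fun n => V n ω) atTop (𝓝 (X T ω i - c)) := by
    filter_upwards [hX0, hXZ, hX.continuousOn] with ω w1 w2 w3
    have := tendsto_sum_mul_increment hT.le hb hqc (x := fun t => X t ω)
      (fun j => (continuous_apply j).comp_continuousOn w3) hqb (z := fun t j => Z t j ω) w2
    convert this using 2
    · simp [V, Finset.sum_apply]
    · simp_rw [hqT, w1, hc]
      simp [Matrix.one_apply]
  have hflow : flowIntegrand T Y σ i =
      fun r => ∑ j, (Ioc 0 T).indicator (fun r => q r j • τ j r) r := by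
    ext1 r
    by_cases hr : r ∈ Ioc 0 T
    · simp only [flowIntegrand, indicator_of_mem hr]
      ext l
      simp [hq, hτ, Matrix.mul_apply (M := Y T * (Y r)⁻¹)]
    · simp [flowIntegrand, hr]
  have hτ2 (j) : MemLp (τ j) 2 (volume.restrict (Ioc 0 T)) := by
    rw [← halfLine_restrict_Ioc, ← memLp_indicator_iff_restrict measurableSet_Ioc]
    exact (hZ T j hTT).1.1
  have hmem : MemLp (flowIntegrand T Y σ i) 2 halfLine := by
    rw [hflow]
    refine memLp_finsetSum _ fun j _ => ?_
    rw [memLp_indicator_iff_restrict measurableSet_Ioc, halfLine_restrict_Ioc]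
    exact memLp_continuousOn_smul (hqc j) (hτ2 j)
  have hgh : Tendsto (fun n => eLpNorm (g n - flowIntegrand T Y σ i) 2 halfLine) atTop (𝓝 0) := by
    set D : ℝ → ℝ := fun r => ∑ j, ‖(Ioc 0 T).indicator (τ j) r‖ with hD
    have hD2 : MemLp D 2 halfLine := memLp_finsetSum _ fun j _ => (hZ T j hTT).1.1.norm
    have hbound (ε : ℝ) (hε : 0 < ε) : ∀ᶠ n in atTop,
        eLpNorm (g n - flowIntegrand T Y σ i) 2 halfLine ≤
          ENNReal.ofReal ε * eLpNorm D 2 halfLine := by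
      have hosc : ∀ᶠ n : ℕ in atTop, ∀ j, ∀ r ∈ Icc 0 T, ∀ s ∈ Icc 0 T,
          |s - r| ≤ T / ((n : ℝ) + 1) → |q s j - q r j| ≤ ε := by
        refine eventually_all.2 fun j => ?_
        have huc := isCompact_Icc.uniformContinuousOn_of_continuous (hqc j)
        rw [Metric.uniformContinuousOn_iff] at huc
        obtain ⟨δ, hδ, h⟩ := huc ε hε
        filter_upwards [eventually_mesh_lt T hδ] with n hn r hr s hs hsr
        exact (h s hs r hr (hsr.trans_lt hn)).le
      filter_upwards [hosc] with n hn
      refine eLpNorm_le_mul_eLpNorm_of_ae_le_mul (ae_of_all _ fun r => ?_) 2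
      have e : (g n - flowIntegrand T Y σ i) r = ∑ j, (∑ k ∈ Finset.range (n + 1),
          q (node T n k) j • ((Ioc 0 (node T n (k + 1))).indicator (τ j) r -
            (Ioc 0 (node T n k)).indicator (τ j) r) -
          (Ioc 0 T).indicator (fun r => q r j • τ j r) r) := by
        rw [hflow, Finset.sum_sub_distrib, Finset.sum_comm]
        simp [g, Finset.sum_apply]
      rw [e, Real.norm_of_nonneg (Finset.sum_nonneg fun j _ => norm_nonneg _), Finset.mul_sum]
      exact (norm_sum_le _ _).trans (Finset.sum_le_sum fun j _ =>
        norm_sum_indicator_sub_le hT.le (τ j) (hn j) r)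
    have hDtop : eLpNorm D 2 halfLine ≠ ∞ := hD2.2.ne
    rw [ENNReal.tendsto_nhds_zero]
    intro η hη
    have hcont : Tendsto (fun ε : ℝ => ENNReal.ofReal ε * eLpNorm D 2 halfLine) (𝓝[>] 0)
        (𝓝 (ENNReal.ofReal 0 * eLpNorm D 2 halfLine)) :=
      (ENNReal.Tendsto.mul_const ((ENNReal.continuous_ofReal.tendsto 0).mono_left
        nhdsWithin_le_nhds) (Or.inr hDtop))
    rw [ENNReal.ofReal_zero, zero_mul] at hcont
    obtain ⟨ε, h1, h2⟩ := ((hcont.eventually (ge_mem_nhds hη)).and self_mem_nhdsWithin).exists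
    filter_upwards [hbound ε h2] with n hn
    exact hn.trans h1
  have hXm : AEStronglyMeasurable (fun ω => X T ω i - c) P :=
    ((aemeasurable_pi_iff.1 (hX.aemeasurable T hTT) i).sub_const c).aestronglyMeasurable
  exact ⟨c, fun ω => X T ω i - c, IsWienerIntegral.of_tendsto_ae hB hV hmem hgh hXm hlim,
    ae_of_all _ fun ω => by simp⟩

end Representation

/-! ### The Malliavin matrix -/

section MalliavinMatrix

variable {m d : ℕ} {T : ℝ} {b : ℝ → Matrix (Fin m) (Fin m) ℝ} {σ : ℝ → Matrix (Fin m) (Fin d) ℝ}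
variable {Y : ℝ → Matrix (Fin m) (Fin m) ℝ}

lemma IsFirstVariation.intervalIntegrable_inv_mul (hY : IsFirstVariation T b Y) (hT : 0 < T)
    (hb : ∀ i j, IntegrableOn (fun t => b t i j) (Icc 0 T))
    (hσ : ∀ i l, MemLp (fun t => σ t i l) 2 (volume.restrict (Icc 0 T))) (i j : Fin m) :
    IntervalIntegrable
      (fun r => ((Y r)⁻¹ * σ r * (σ r).transpose * ((Y r)⁻¹).transpose) i j) volume 0 T := by
  have hN := hY.continuousOn_inv hb
  rw [intervalIntegrable_iff_integrableOn_Ioc_of_le hT.le]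
  have hNσ (k : Fin m) (l : Fin d) :
      MemLp (fun r => ((Y r)⁻¹ * σ r) k l) 2 (volume.restrict (Ioc 0 T)) := by
    simp only [Matrix.mul_apply]
    exact memLp_finsetSum _ fun p _ => memLp_continuousOn_smul (hN.matrix_entry k p)
      ((hσ p l).mono_measure (Measure.restrict_mono Ioc_subset_Icc_self le_rfl))
  have e (r : ℝ) : ((Y r)⁻¹ * σ r * (σ r).transpose * ((Y r)⁻¹).transpose) i j =
      ∑ l, ((Y r)⁻¹ * σ r) i l * ((Y r)⁻¹ * σ r) j l := by
    rw [Matrix.mul_assoc, ← Matrix.transpose_mul, Matrix.mul_apply]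
    rfl
  simp_rw [e]
  exact integrable_finsetSum _ fun l _ => (hNσ i l).integrable_mul (hNσ j l)

lemma integral_inner_flowIntegrand (hT : 0 < T)
    (hint : ∀ i j, IntervalIntegrable
      (fun r => ((Y r)⁻¹ * σ r * (σ r).transpose * ((Y r)⁻¹).transpose) i j) volume 0 T)
    (i j : Fin m) :
    ∫ r, inner ℝ (flowIntegrand T Y σ i r) (flowIntegrand T Y σ j r) ∂halfLine =
      (Y T * (Matrix.of fun i j => ∫ r in (0 : ℝ)..T,
        ((Y r)⁻¹ * σ r * (σ r).transpose * ((Y r)⁻¹).transpose) i j) * (Y T).transpose) i j := by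
  have e1 (r : ℝ) : (inner ℝ (flowIntegrand T Y σ i r) (flowIntegrand T Y σ j r) : ℝ) =
      (Ioc 0 T).indicator (fun r => (Y T * ((Y r)⁻¹ * σ r * (σ r).transpose *
        ((Y r)⁻¹).transpose) * (Y T).transpose) i j) r := by
    by_cases hr : r ∈ Ioc 0 T
    · have e : Y T * ((Y r)⁻¹ * σ r * (σ r).transpose * ((Y r)⁻¹).transpose) * (Y T).transpose =
          (Y T * (Y r)⁻¹ * σ r) * (Y T * (Y r)⁻¹ * σ r).transpose := by
        simp only [Matrix.transpose_mul, Matrix.mul_assoc]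
      simp only [flowIntegrand, indicator_of_mem hr]
      rw [e, Matrix.mul_apply]
      simp [PiLp.inner_apply, mul_comm]
    · simp [flowIntegrand, hr]
  simp_rw [e1]
  rw [integral_indicator measurableSet_Ioc, halfLine_restrict_Ioc,
    ← intervalIntegral.integral_of_le hT.le]
  have e2 (M : Matrix (Fin m) (Fin m) ℝ) : (Y T * M * (Y T).transpose) i j =
      ∑ p, ∑ q, Y T i p * Y T j q * M p q := by
    simp only [Matrix.mul_apply, Finset.sum_mul, Matrix.transpose_apply]
    rw [Finset.sum_comm]
    exact Finset.sum_congr rfl fun p _ => Finset.sum_congr rfl fun q _ => by ring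
  simp_rw [e2, Matrix.of_apply]
  have hsum (p) : IntervalIntegrable (fun r => ∑ q, Y T i p * Y T j q *
      ((Y r)⁻¹ * σ r * (σ r).transpose * ((Y r)⁻¹).transpose) p q) volume 0 T := by
    have := IntervalIntegrable.sum Finset.univ fun q _ => (hint p q).const_mul (Y T i p * Y T j q)
    rwa [Finset.sum_fn] at this
  rw [intervalIntegral.integral_finsetSum fun p _ => hsum p]
  refine Finset.sum_congr rfl fun p _ => ?_
  rw [intervalIntegral.integral_finsetSum fun q _ => (hint p q).const_mul _]
  exact Finset.sum_congr rfl fun q _ => intervalIntegral.integral_const_mul _ _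

end MalliavinMatrix

end MalliavinSDE

theorem mainTheorem3 {Ω : Type*} [MeasurableSpace Ω] (P : Measure Ω) [IsProbabilityMeasure P]
    {d m : ℕ} (B : ℝ≥0 → Ω → EuclideanSpace ℝ (Fin d)) (hB : MalliavinSDE.IsBrownianMotion B P)
    (T : ℝ) (hT : 0 < T)
    (b : ℝ → Matrix (Fin m) (Fin m) ℝ)
    (hb : ∀ i j, IntegrableOn (fun t => b t i j) (Icc 0 T))
    (σ : ℝ → Matrix (Fin m) (Fin d) ℝ)
    (hσ : ∀ i l, MemLp (fun t => σ t i l) 2 (volume.restrict (Icc 0 T)))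
    (x₀ : Fin m → ℝ) (X : ℝ → Ω → Fin m → ℝ)
    (hX : MalliavinSDE.IsLinearSDESolution B P T b σ x₀ X)
    (Y : ℝ → Matrix (Fin m) (Fin m) ℝ) (hY : MalliavinSDE.IsFirstVariation T b Y) :
    (∀ r ∈ Icc 0 T, IsUnit (Y r)) ∧
    (∀ i, MalliavinSDE.MemD12 B P (fun ω => X T ω i)) ∧
    (∀ᵐ p ∂(P.prod (volume.restrict (Ioc 0 T))),
      MalliavinSDE.malliavinJacobian B P (X T) p.1 p.2 = Y T * (Y p.2)⁻¹ * σ p.2) ∧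
    (∀ᵐ p ∂(P.prod (volume.restrict (Ioi T))),
      MalliavinSDE.malliavinJacobian B P (X T) p.1 p.2 = 0) ∧
    (∀ i j, IntervalIntegrable
      (fun r => ((Y r)⁻¹ * σ r * (σ r).transpose * ((Y r)⁻¹).transpose) i j) volume 0 T) ∧
    (∀ᵐ ω ∂P, MalliavinSDE.malliavinMatrix B P (X T) ω =
      Y T * (Matrix.of fun i j => ∫ r in (0 : ℝ)..T,
        ((Y r)⁻¹ * σ r * (σ r).transpose * ((Y r)⁻¹).transpose) i j) * (Y T).transpose) := by
  have hM (i) : MalliavinSDE.IsMalliavinDerivative B P (fun ω => X T ω i)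
      (fun _ r => MalliavinSDE.flowIntegrand T Y σ i r) := by
    obtain ⟨c, ξ, hξ, he⟩ := hX.exists_isWienerIntegral hB hT hb hY i
    exact hξ.isMalliavinDerivative_const_add hB c he
  have hD : ∀ᵐ p ∂(P.prod MalliavinSDE.halfLine), ∀ i,
      MalliavinSDE.malliavinDeriv B P (fun ω => X T ω i) p.1 p.2 =
        MalliavinSDE.flowIntegrand T Y σ i p.2 :=
    ae_all_iff.2 fun i => (hM i).malliavinDeriv_ae_eq hB
  have hD' {s : Set ℝ} (hs : s ⊆ Ioi 0) (hsm : MeasurableSet s) :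
      ∀ᵐ p ∂(P.prod (volume.restrict s)), p.2 ∈ s ∧ ∀ i,
        MalliavinSDE.malliavinDeriv B P (fun ω => X T ω i) p.1 p.2 =
          MalliavinSDE.flowIntegrand T Y σ i p.2 := by
    have hac : P.prod (volume.restrict s) ≪ P.prod MalliavinSDE.halfLine :=
      Measure.AbsolutelyContinuous.rfl.prod
        (Measure.absolutelyContinuous_of_le (Measure.restrict_mono hs le_rfl))
    filter_upwards [hac.ae_le hD,
      Measure.quasiMeasurePreserving_snd.ae (ae_restrict_mem hsm)] with p h1 h2
    exact ⟨h2, h1⟩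
  have hint := hY.intervalIntegrable_inv_mul hT hb hσ
  refine ⟨fun r hr => hY.isUnit hb hr, fun i => ⟨_, hM i⟩, ?_, ?_, hint, ?_⟩
  · filter_upwards [hD' (fun r hr => hr.1) measurableSet_Ioc] with p hp
    ext i l
    simp [MalliavinSDE.malliavinJacobian, hp.2, MalliavinSDE.flowIntegrand, hp.1]
  · filter_upwards [hD' (s := Ioi T) (fun r hr => hT.trans hr) measurableSet_Ioi] with p hp
    have : p.2 ∉ Ioc 0 T := fun h => absurd h.2 (not_le.2 hp.1)
    ext i l
    simp [MalliavinSDE.malliavinJacobian, hp.2, MalliavinSDE.flowIntegrand, this]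
  · filter_upwards [Measure.ae_ae_of_ae_prod hD] with ω hω
    ext i j
    rw [← MalliavinSDE.integral_inner_flowIntegrand hT hint]
    refine integral_congr_ae ?_
    filter_upwards [hω] with r hr
    rw [hr i, hr j]
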